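/- For a finite group $G$ let $\pi_e(G)$ be the set of orders of its elements. Write $\mathbb{Z}_n$ for the cyclic group of order $n$, and $S_n$, $A_n$ for the symmetric and alternating groups on $n$ letters. Consider the following seven groups: 1. $\mathbb{Z}_2\times\mathbb{Z}_6$ (order $12$, $\pi_e=\{1,2,3,6\}$, GAP ID $[12,5]$); 2. $\mathbb{Z}_3\times S_3$ (order $18$, $\pi_e=\{1,2,3,6\}$, GAP ID $[18,3]$); 3. $\mathbb{Z}_2\times(\mathbb{Z}_3\rtimes\mathbb{Z}_4)$, where a generator of $\mathbb{Z}_4$ inverts $\mathbb{Z}_3$ (order $24$, $\pi_e=\{1,2,3,4,6\}$, GAP ID $[24,7]$); 4. $(\mathbb{Z}_6\times\mathbb{Z}_2)\rtimes\mathbb{Z}_2$, where the generator of the acting $\mathbb{Z}_2$ acts by $(x,y)\mapsto(-x+3y,\,y)$, with $3y$ read as the image of $y$ under the injective homomorphism $\mathbb{Z}_2\to\mathbb{Z}_6$ (order $24$, $\pi_e=\{1,2,3,4,6\}$, GAP ID $[24,8]$); 5. $\mathbb{Z}_2\times\mathbb{Z}_2\times S_3$ (order $24$, $\pi_e=\{1,2,3,6\}$,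 GAP ID $[24,14]$); 6. $\mathbb{Z}_3\times A_4$ (order $36$, $\pi_e=\{1,2,3,6\}$, GAP ID $[36,11]$); 7. $(\mathbb{Z}_3\times A_4)\rtimes\mathbb{Z}_2$, where the generator of $\mathbb{Z}_2$ inverts $\mathbb{Z}_3$ and acts on $A_4$ as conjugation by a transposition of $S_4$ (order $72$, $\pi_e=\{1,2,3,4,6\}$, GAP ID $[72,43]$). Each of these groups has the stated order and the stated set $\pi_e$, and has exactly three cyclic subgroups of order $6$. Moreover, let $G$ be any finite group with $\pi_e(G)\subseteq\{1,2,3,4,6\}$ that has exactly three cyclic subgroups of order $6$. Then there exist two distinct cyclic subgroups of order $6$ of $G$ whose intersection has order $3$ if and only if $G$ is isomorphic to one of the seven groups above. -/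

import Mathlib

/-- The set of orders of the elements of a group, usually written `π_e(G)`. -/
def elementOrders (G : Type*) [Group G] : Set ℕ := Set.range (orderOf : G → ℕ)

/-- The set of cyclic subgroups of order `n` of `G`. -/
def cyclicSubgroups (G : Type*) [Group G] (n : ℕ) : Set (Subgroup G) :=
  {H | IsCyclic H ∧ Nat.card H = n}

/-- The cyclic group `ℤ_n`, written multiplicatively. -/
abbrev Cyc (n : ℕ) : Type := Multiplicative (ZMod n)

/-- The action of `ℤ_n` on a group `N` in which the generator `1` acts by an automorphism `α`
with `α ^ n = 1`; the element `k` acts by `α ^ k`. -/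
def cyclicAction {N : Type*} [Group N] (n : ℕ) [NeZero n] (α : MulAut N) (hα : α ^ n = 1) :
    Cyc n →* MulAut N where
  toFun k := α ^ (Multiplicative.toAdd k).val
  map_one' := by simp
  map_mul' a b := by
    rw [toAdd_mul, ZMod.val_add, ← pow_add, ← pow_eq_pow_mod _ hα]

/-- Inversion on `ℤ_3`. -/
abbrev invThree : MulAut (Cyc 3) := MulEquiv.inv (Cyc 3)

theorem invThree_pow_four : invThree ^ 4 = 1 := by
  ext x; revert x; decide

/-- `ℤ_3 ⋊ ℤ_4`, the generator of `ℤ_4` inverting `ℤ_3`. -/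
abbrev ThreeByFour : Type := Cyc 3 ⋊[cyclicAction 4 invThree invThree_pow_four] Cyc 4

/-- The automorphism `(x, y) ↦ (-x + 3 y, y)` of `ℤ_6 × ℤ_2`. -/
def autSixTwo : MulAut (Cyc 6 × Cyc 2) where
  toFun p := (Multiplicative.ofAdd
    (-(Multiplicative.toAdd p.1) + 3 * ((Multiplicative.toAdd p.2).val : ZMod 6)), p.2)
  invFun p := (Multiplicative.ofAdd
    (-(Multiplicative.toAdd p.1) + 3 * ((Multiplicative.toAdd p.2).val : ZMod 6)), p.2)
  left_inv := by unfold Function.LeftInverse; decide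
  right_inv := by unfold Function.RightInverse Function.LeftInverse; decide
  map_mul' := by decide

theorem autSixTwo_sq : autSixTwo ^ 2 = 1 := by
  apply MulEquiv.ext; decide

/-- `(ℤ_6 × ℤ_2) ⋊ ℤ_2`, the generator of the acting `ℤ_2` acting by
`(x, y) ↦ (-x + 3 y, y)`. -/
abbrev SixTwoByTwo : Type := (Cyc 6 × Cyc 2) ⋊[cyclicAction 2 autSixTwo autSixTwo_sq] Cyc 2

/-- The automorphism of `ℤ_3 × A_4` that inverts `ℤ_3` and conjugates `A_4` by the transposition
`(0 1)` of `S_4`. -/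
def autThreeAlt : MulAut (Cyc 3 × alternatingGroup (Fin 4)) :=
  MulEquiv.prodCongr invThree (MulAut.conjNormal (Equiv.swap (0 : Fin 4) 1))

theorem autThreeAlt_sq : autThreeAlt ^ 2 = 1 := by
  have h : (MulAut.conjNormal (H := alternatingGroup (Fin 4)) (Equiv.swap (0 : Fin 4) 1)) ^ 2
      = 1 := by
    rw [← map_pow, pow_two, Equiv.swap_mul_self, map_one]
  apply MulEquiv.ext
  rintro ⟨x, s⟩
  refine Prod.ext ?_ ?_
  · change (x⁻¹)⁻¹ = x
    exact inv_inv x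
  · exact DFunLike.congr_fun h s

/-- `(ℤ_3 × A_4) ⋊ ℤ_2`, the generator of `ℤ_2` inverting `ℤ_3` and acting on `A_4` as
conjugation by a transposition of `S_4`. -/
abbrev ThreeAltByTwo : Type :=
  (Cyc 3 × alternatingGroup (Fin 4)) ⋊[cyclicAction 2 autThreeAlt autThreeAlt_sq] Cyc 2

/-- `G` has order `n`, its set of element orders is `S`, and it has exactly three cyclic subgroups
of order `6`. -/
def HasInvariants (G : Type*) [Group G] (n : ℕ) (S : Set ℕ) : Prop :=
  Nat.card G = n ∧ elementOrders G = S ∧ (cyclicSubgroups G 6).ncard = 3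

/-! Let two cyclic subgroups of order 6 meet in ⟨t⟩ of order 3, and let u, v be their involutions.
Both commute with t, and so does a third involution w: it is uv if u and v commute, and uvu
otherwise. The elements tu, tv, tw have the same square and generate three distinct cyclic subgroups
of order 6, hence all of them. So an element of order 3 commutes with an involution only if it is t
or t⁻¹ and the involution is u, v or w (`sixData_of_ncard`). It follows that ⟨t⟩ is normal, its
centralizer C(t) has index at most 2, and G permutes {u, v, w}. Since no element has order 12, x⁶ =
1 on C(t), while g⁴ = 1 off C(t).

If u and v do not commute, they generate a copy of S₃ that already induces every permutation of {u,
v, w}. The kernel of that action is ⟨t⟩, so G is ℤ₃ × S₃.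

If they commute, V = {1, a, b, ab} is a normal Klein four group with centralizer ⟨t⟩ × V in C(t).
Elements of C(t) have cubes in V, so they act on V trivially or as 3-cycles. The other elements have
squares in V, so they act trivially or as transpositions. Which of these actions occur, and the
square of an outer element when all actions are trivial, separate the remaining six groups.
Multiplying representatives by elements of V turns them into complements (`exists_involution`,
`exists_inverted_rotation`).

Conversely, each listed group has explicit elements of order 6 with a common square, which a finite
computation verifies. -/

/-! ### Homomorphisms out of cyclic groups and their products -/

/-- The homomorphism from `ℤ_n` sending the generator to `g`. -/
def cycHom {G : Type*} [Group G] (n : ℕ) [NeZero n] (g : G) (hg : g ^ n = 1) : Cyc n →* G where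
  toFun k := g ^ (Multiplicative.toAdd k).val
  map_one' := by simp
  map_mul' a b := by
    rw [toAdd_mul, ZMod.val_add, ← pow_add, ← pow_eq_pow_mod _ hg]

theorem cycHom_apply {G : Type*} [Group G] (n : ℕ) [NeZero n] (g : G) (hg : g ^ n = 1)
    (k : Cyc n) : cycHom n g hg k = g ^ (Multiplicative.toAdd k).val := rfl

theorem cycHom_gen {G : Type*} [Group G] (n : ℕ) [NeZero n] (hn : 1 < n) (g : G)
    (hg : g ^ n = 1) : cycHom n g hg (Multiplicative.ofAdd 1) = g := by
  have : Fact (1 < n) := ⟨hn⟩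
  simp [cycHom_apply, ZMod.val_one]

/-- The homomorphism from `N ⋊ ℤ_n` given by a homomorphism from `N` and a compatible element. -/
def cyclicLift {N G : Type*} [Group N] [Group G] {n : ℕ} [NeZero n] {α : MulAut N}
    (hα : α ^ n = 1) (f : N →* G) (g : G) (hg : g ^ n = 1)
    (h : ∀ x, f (α x) = g * f x * g⁻¹) : N ⋊[cyclicAction n α hα] Cyc n →* G :=
  SemidirectProduct.lift f (cycHom n g hg) (by
    intro k
    have key : ∀ m : ℕ, ∀ x, f ((α ^ m) x) = g ^ m * f x * (g ^ m)⁻¹ := by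
      intro m
      induction m with
      | zero => simp
      | succ m ih =>
        intro x
        rw [pow_succ', MulAut.mul_apply, h, ih, pow_succ']
        group
    ext x
    exact key _ x)

section
variable {N G : Type*} [Group N] [Group G] {n : ℕ} [NeZero n] {α : MulAut N}
    {hα : α ^ n = 1} {f : N →* G} {g : G} {hg : g ^ n = 1}
    {h : ∀ x, f (α x) = g * f x * g⁻¹}

theorem cyclicLift_apply (x : N ⋊[cyclicAction n α hα] Cyc n) :
    cyclicLift hα f g hg h x = f x.left * g ^ (Multiplicative.toAdd x.right).val := rfl

theorem cyclicLift_inl (x : N) : cyclicLift hα f g hg h (SemidirectProduct.inl x) = f x := by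
  simp [cyclicLift_apply]

theorem cyclicLift_gen (hn : 1 < n) :
    cyclicLift hα f g hg h (SemidirectProduct.inr (Multiplicative.ofAdd 1)) = g := by
  have : Fact (1 < n) := ⟨hn⟩
  simp [cyclicLift_apply, ZMod.val_one]

/-- The condition `hd` says at once that `g` has order exactly `n` and that its powers meet the
range of `f` trivially; a kernel element would express some `g ^ k` as a value of `f`. -/
theorem cyclicLift_injective (hf : Function.Injective f)
    (hd : ∀ d, 0 < d → d < n → g ^ d ∉ f.range) :
    Function.Injective (cyclicLift hα f g hg h) := by
  rw [injective_iff_map_eq_one]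
  intro x hx
  rw [cyclicLift_apply] at hx
  have h0 : (Multiplicative.toAdd x.right).val = 0 := by
    by_contra hne
    refine hd _ (Nat.pos_of_ne_zero hne) (ZMod.val_lt _) ⟨x.left⁻¹, ?_⟩
    rw [map_inv, inv_eq_of_mul_eq_one_right hx]
  have h1 : x.right = 1 := (ZMod.val_eq_zero _).1 h0
  rw [h0, pow_zero, mul_one] at hx
  exact SemidirectProduct.ext ((injective_iff_map_eq_one f).1 hf _ hx) h1

theorem cyclicLift_bijective (hf : Function.Injective f)
    (hd : ∀ d, 0 < d → d < n → g ^ d ∉ f.range)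
    (hs : ∀ y : G, ∃ x, ∃ k : ℕ, y = f x * g ^ k) :
    Function.Bijective (cyclicLift hα f g hg h) := by
  refine ⟨cyclicLift_injective hf hd, fun y => ?_⟩
  obtain ⟨x, k, rfl⟩ := hs y
  refine ⟨⟨x, Multiplicative.ofAdd (k : ZMod n)⟩, ?_⟩
  rw [cyclicLift_apply, toAdd_ofAdd, ZMod.val_natCast, ← pow_eq_pow_mod _ hg]

end

/-- The homomorphism from `ℤ_n × N` given by a homomorphism from `N` and an element commuting
with its range. -/
def cycProd {N G : Type*} [Group N] [Group G] (n : ℕ) [NeZero n] (g : G) (hg : g ^ n = 1)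
    (f : N →* G) (h : ∀ x, Commute g (f x)) : Cyc n × N →* G :=
  (cycHom n g hg).noncommCoprod f fun _ x => (h x).pow_left _

section
variable {N G : Type*} [Group N] [Group G] {n : ℕ} [NeZero n] {g : G} {hg : g ^ n = 1}
    {f : N →* G} {h : ∀ x, Commute g (f x)}

theorem cycProd_apply (x : Cyc n × N) :
    cycProd n g hg f h x = g ^ (Multiplicative.toAdd x.1).val * f x.2 := rfl

theorem cycProd_injective (hf : Function.Injective f)
    (hd : ∀ d, 0 < d → d < n → g ^ d ∉ f.range) :
    Function.Injective (cycProd n g hg f h) := by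
  rw [injective_iff_map_eq_one]
  intro x hx
  rw [cycProd_apply] at hx
  have h0 : (Multiplicative.toAdd x.1).val = 0 := by
    by_contra hne
    refine hd _ (Nat.pos_of_ne_zero hne) (ZMod.val_lt _) ⟨x.2⁻¹, ?_⟩
    rw [map_inv, inv_eq_of_mul_eq_one_left hx]
  have h1 : x.1 = 1 := (ZMod.val_eq_zero _).1 h0
  rw [h0, pow_zero, one_mul] at hx
  exact Prod.ext h1 ((injective_iff_map_eq_one f).1 hf _ hx)

theorem cycProd_bijective (hf : Function.Injective f)
    (hd : ∀ d, 0 < d → d < n → g ^ d ∉ f.range)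
    (hs : ∀ y : G, ∃ x, ∃ k : ℕ, y = g ^ k * f x) :
    Function.Bijective (cycProd n g hg f h) := by
  refine ⟨cycProd_injective hf hd, fun y => ?_⟩
  obtain ⟨x, k, rfl⟩ := hs y
  refine ⟨⟨Multiplicative.ofAdd (k : ZMod n), x⟩, ?_⟩
  rw [cycProd_apply, toAdd_ofAdd, ZMod.val_natCast, ← pow_eq_pow_mod _ hg]

end

theorem cycHom_injective {G : Type*} [Group G] {n : ℕ} [NeZero n] {g : G} {hg : g ^ n = 1}
    (hd : ∀ d, 0 < d → d < n → g ^ d ≠ 1) : Function.Injective (cycHom n g hg) := by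
  rw [injective_iff_map_eq_one]
  intro x hx
  by_contra hne
  exact hd _ (Nat.pos_of_ne_zero fun h0 => hne ((ZMod.val_eq_zero _).1 h0)) (ZMod.val_lt _) hx

/-! ### Elements and cyclic subgroups of order six -/

theorem orderOf_eq_six_iff {G : Type*} [Group G] (x : G) :
    orderOf x = 6 ↔ x ^ 6 = 1 ∧ x ^ 2 ≠ 1 ∧ x ^ 3 ≠ 1 := by
  constructor
  · intro h
    refine ⟨h ▸ pow_orderOf_eq_one x, fun h2 => ?_, fun h3 => ?_⟩
    · have := Nat.le_of_dvd two_pos (orderOf_dvd_of_pow_eq_one h2)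
      omega
    · have := Nat.le_of_dvd three_pos (orderOf_dvd_of_pow_eq_one h3)
      omega
  · rintro ⟨h6, h2, h3⟩
    have hd := orderOf_dvd_of_pow_eq_one h6
    have hle := Nat.le_of_dvd (by norm_num) hd
    rw [ne_eq, ← orderOf_dvd_iff_pow_eq_one] at h2 h3
    interval_cases orderOf x <;> revert hd h2 h3 <;> decide

theorem zpowers_mem_cyclicSubgroups {G : Type*} [Group G] {x : G} {n : ℕ} (hx : orderOf x = n) :
    Subgroup.zpowers x ∈ cyclicSubgroups G n :=
  ⟨inferInstance, by rw [Nat.card_zpowers, hx]⟩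

theorem exists_generator {G : Type*} [Group G] {H : Subgroup G} {n : ℕ}
    (hH : H ∈ cyclicSubgroups G n) : ∃ x, orderOf x = n ∧ H = Subgroup.zpowers x := by
  obtain ⟨hc, hn⟩ := hH
  obtain ⟨x, rfl⟩ := (Subgroup.isCyclic_iff_exists_zpowers_eq_top H).1 hc
  exact ⟨x, by rw [← hn, Nat.card_zpowers], rfl⟩

/-- The only units modulo 6 are 1 and -1. -/
theorem zpowers_eq_iff_of_orderOf_eq_six {G : Type*} [Group G] {x y : G} (hx : orderOf x = 6)
    (hy : orderOf y = 6) :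
    Subgroup.zpowers x = Subgroup.zpowers y ↔ y = x ∨ y = x⁻¹ := by
  constructor
  · intro h
    classical
    have hfin : IsOfFinOrder x := orderOf_pos_iff.1 (by omega)
    have hm : y ∈ Subgroup.zpowers x := h ▸ Subgroup.mem_zpowers y
    rw [hfin.mem_zpowers_iff_mem_range_orderOf, hx] at hm
    simp only [Finset.mem_image, Finset.mem_range] at hm
    obtain ⟨k, hk, rfl⟩ := hm
    rw [orderOf_pow' x (by rintro rfl; simp at hy), hx] at hy
    have h6 : x ^ 6 = 1 := hx ▸ pow_orderOf_eq_one x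
    interval_cases k <;> simp at hy ⊢
    exact Or.inr (eq_inv_of_mul_eq_one_left (by rw [← pow_succ, h6]))
  · rintro (rfl | rfl) <;> simp

/-- The elements `x`, `y`, `z` have order six and the same square, and with their inverses they
are all the elements of order six. -/
def SixElements {G : Type*} [Group G] (x y z : G) : Prop :=
  (x ^ 6 = 1 ∧ x ^ 2 ≠ 1 ∧ x ^ 3 ≠ 1) ∧ (y ^ 2 = x ^ 2 ∧ y ^ 3 ≠ 1 ∧ y ≠ x) ∧
    (z ^ 2 = x ^ 2 ∧ z ^ 3 ≠ 1 ∧ z ≠ x ∧ z ≠ y) ∧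
    ∀ g : G, g ^ 6 = 1 → g ^ 2 = 1 ∨ g ^ 3 = 1 ∨
      g = x ∨ g = x⁻¹ ∨ g = y ∨ g = y⁻¹ ∨ g = z ∨ g = z⁻¹

section
variable {G : Type*} [Group G] {x y z : G}

theorem orderOf_eq_six_of_sq_eq (hx : x ^ 6 = 1 ∧ x ^ 2 ≠ 1 ∧ x ^ 3 ≠ 1)
    (h : y ^ 2 = x ^ 2) (hy : y ^ 3 ≠ 1) : orderOf y = 6 := by
  rw [orderOf_eq_six_iff]
  exact ⟨by rw [pow_mul y 2 3, h, ← pow_mul, hx.1], h ▸ hx.2.1, hy⟩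

/-- The remaining possibility `y = x⁻¹` would give `x ^ 4 = 1`. -/
theorem zpowers_ne_of_sq_eq (hx : orderOf x = 6) (hy : orderOf y = 6) (h : y ^ 2 = x ^ 2)
    (hne : y ≠ x) : Subgroup.zpowers x ≠ Subgroup.zpowers y := by
  rw [ne_eq, zpowers_eq_iff_of_orderOf_eq_six hx hy]
  rintro (rfl | rfl)
  · exact hne rfl
  · rw [inv_pow, inv_eq_iff_mul_eq_one, ← pow_add] at h
    have := Nat.le_of_dvd (by norm_num) (orderOf_dvd_of_pow_eq_one h)
    omega

/-- The intersection contains the common subgroup generated by `x ^ 2`, and it is proper because the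
two subgroups differ. -/
theorem card_inf_zpowers_of_sq_eq (hx : orderOf x = 6) (hy : orderOf y = 6) (h : y ^ 2 = x ^ 2)
    (hne : y ≠ x) : Nat.card (Subgroup.zpowers x ⊓ Subgroup.zpowers y : Subgroup G) = 3 := by
  have hcx : Nat.card (Subgroup.zpowers x) = 6 := by rw [Nat.card_zpowers, hx]
  have hcy : Nat.card (Subgroup.zpowers y) = 6 := by rw [Nat.card_zpowers, hy]
  have hfx : Finite (Subgroup.zpowers x) := Nat.finite_of_card_ne_zero (by omega)
  have hfy : Finite (Subgroup.zpowers y) := Nat.finite_of_card_ne_zero (by omega)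
  have h6 : Nat.card (Subgroup.zpowers x ⊓ Subgroup.zpowers y : Subgroup G) ∣ 6 :=
    hcx ▸ Subgroup.card_dvd_of_le inf_le_left
  have h3 : 3 ∣ Nat.card (Subgroup.zpowers x ⊓ Subgroup.zpowers y : Subgroup G) := by
    have : Nat.card (Subgroup.zpowers (x ^ 2)) = 3 := by
      rw [Nat.card_zpowers, orderOf_pow' x two_ne_zero, hx]; rfl
    rw [← this]
    refine Subgroup.card_dvd_of_le (le_inf ?_ ?_)
    · simp
    · rw [← h]
      simp
  have hn6 : Nat.card (Subgroup.zpowers x ⊓ Subgroup.zpowers y : Subgroup G) ≠ 6 := by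
    intro hc
    have h1 := Subgroup.eq_of_le_of_card_ge
      (inf_le_left : Subgroup.zpowers x ⊓ Subgroup.zpowers y ≤ _) (by omega)
    have h2 := Subgroup.eq_of_le_of_card_ge
      (inf_le_right : Subgroup.zpowers x ⊓ Subgroup.zpowers y ≤ _) (by omega)
    exact zpowers_ne_of_sq_eq hx hy h hne (h1.symm.trans h2)
  obtain ⟨k, hk⟩ := h3
  rw [hk] at h6 hn6 ⊢
  have : k ≤ 2 := by have := Nat.le_of_dvd (by norm_num) h6; omega
  interval_cases k <;> omega

theorem SixElements.orderOf_eq (h : SixElements x y z) :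
    orderOf x = 6 ∧ orderOf y = 6 ∧ orderOf z = 6 :=
  ⟨orderOf_eq_six_of_sq_eq h.1 rfl h.1.2.2, orderOf_eq_six_of_sq_eq h.1 h.2.1.1 h.2.1.2.1,
    orderOf_eq_six_of_sq_eq h.1 h.2.2.1.1 h.2.2.1.2.1⟩

theorem SixElements.ncard_cyclicSubgroups (h : SixElements x y z) :
    (cyclicSubgroups G 6).ncard = 3 := by
  obtain ⟨hx, hy, hz⟩ := h.orderOf_eq
  obtain ⟨-, ⟨h1, -, h2⟩, ⟨h3, -, h4, h5⟩, hall⟩ := h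
  rw [Set.ncard_eq_three]
  refine ⟨_, _, _, zpowers_ne_of_sq_eq hx hy h1 h2, zpowers_ne_of_sq_eq hx hz h3 h4,
    zpowers_ne_of_sq_eq hy hz (h3.trans h1.symm) h5, ?_⟩
  ext H
  simp only [Set.mem_insert_iff, Set.mem_singleton_iff]
  constructor
  · intro hH
    obtain ⟨g, hg, rfl⟩ := exists_generator hH
    obtain ⟨g6, g2, g3⟩ := (orderOf_eq_six_iff g).1 hg
    rcases (hall g g6).resolve_left g2 |>.resolve_left g3 with h | h | h | h | h | h <;> simp [h]
  · rintro (rfl | rfl | rfl)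
    exacts [zpowers_mem_cyclicSubgroups hx, zpowers_mem_cyclicSubgroups hy,
      zpowers_mem_cyclicSubgroups hz]

theorem SixElements.mem_elementOrders (h : SixElements x y z) :
    ({1, 2, 3, 6} : Set ℕ) ⊆ elementOrders G := by
  have hx := h.orderOf_eq.1
  rintro _ (rfl | rfl | rfl | rfl)
  · exact ⟨1, orderOf_one⟩
  · exact ⟨x ^ 3, by rw [orderOf_pow' x three_ne_zero, hx]; rfl⟩
  · exact ⟨x ^ 2, by rw [orderOf_pow' x two_ne_zero, hx]; rfl⟩
  · exact ⟨x, hx⟩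

theorem SixElements.hasInvariants {n : ℕ} (h : SixElements x y z) (hn : Nat.card G = n)
    (hall : ∀ g : G, g ^ 6 = 1) : HasInvariants G n {1, 2, 3, 6} := by
  refine ⟨hn, Set.Subset.antisymm ?_ h.mem_elementOrders, h.ncard_cyclicSubgroups⟩
  rintro _ ⟨g, rfl⟩
  have hd := orderOf_dvd_of_pow_eq_one (hall g)
  have hle := Nat.le_of_dvd (by norm_num) hd
  interval_cases orderOf g <;> simp at hd ⊢

theorem orderOf_mem_of_pow (g : G) (h : g ^ 4 = 1 ∨ g ^ 6 = 1) :
    orderOf g ∈ ({1, 2, 3, 4, 6} : Set ℕ) := by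
  rcases h with h | h
  all_goals
    have hd := orderOf_dvd_of_pow_eq_one h
    have hle := Nat.le_of_dvd (by norm_num) hd
    interval_cases orderOf g <;> simp at hd ⊢

theorem SixElements.hasInvariants_of_orderFour {n : ℕ} (h : SixElements x y z)
    (hn : Nat.card G = n) (hall : ∀ g : G, g ^ 4 = 1 ∨ g ^ 6 = 1)
    (hex : ∃ g : G, g ^ 4 = 1 ∧ g ^ 2 ≠ 1) : HasInvariants G n {1, 2, 3, 4, 6} := by
  refine ⟨hn, Set.Subset.antisymm ?_ ?_, h.ncard_cyclicSubgroups⟩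
  · rintro _ ⟨g, rfl⟩
    exact orderOf_mem_of_pow g (hall g)
  · rintro k hk
    by_cases h4 : k = 4
    · obtain ⟨g, hg4, hg2⟩ := hex
      exact ⟨g, by rw [h4]; exact orderOf_eq_prime_pow (p := 2) (n := 1) hg2 hg4⟩
    · refine h.mem_elementOrders ?_
      simp only [Set.mem_insert_iff, Set.mem_singleton_iff] at hk ⊢
      tauto

/-- This settles the "if" direction for every listed group: two generators with the same square are
pulled back along the isomorphism. -/
theorem SixElements.exists_inf {G' : Type*} [Group G'] (h : SixElements x y z) (e : G' ≃* G) :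
    ∃ H ∈ cyclicSubgroups G' 6, ∃ K ∈ cyclicSubgroups G' 6,
      H ≠ K ∧ Nat.card (H ⊓ K : Subgroup G') = 3 := by
  have hx : orderOf (e.symm x) = 6 := by rw [MulEquiv.orderOf_eq, h.orderOf_eq.1]
  have hy : orderOf (e.symm y) = 6 := by rw [MulEquiv.orderOf_eq, h.orderOf_eq.2.1]
  have hs : e.symm y ^ 2 = e.symm x ^ 2 := by rw [← map_pow, ← map_pow, h.2.1.1]
  have hne : e.symm y ≠ e.symm x := e.symm.injective.ne h.2.1.2.2
  exact ⟨_, zpowers_mem_cyclicSubgroups hx, _, zpowers_mem_cyclicSubgroups hy,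
    zpowers_ne_of_sq_eq hx hy hs hne, card_inf_zpowers_of_sq_eq hx hy hs hne⟩

end

/-! ### The seven groups: explicit elements and invariants -/

/-- The elements of a semidirect product of finite groups can be enumerated. -/
instance {N H : Type*} [Group N] [Group H] (φ : H →* MulAut N) [Fintype N] [Fintype H] :
    Fintype (N ⋊[φ] H) :=
  Fintype.ofEquiv _ SemidirectProduct.equivProd.symm

/-- Equality in a semidirect product, decided componentwise. -/
instance {N H : Type*} [Group N] [Group H] (φ : H →* MulAut N) [DecidableEq N] [DecidableEq H] :
    DecidableEq (N ⋊[φ] H) :=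
  fun _ _ => decidable_of_iff _ SemidirectProduct.ext_iff.symm

instance {G : Type*} [Group G] [Fintype G] [DecidableEq G] (x y z : G) :
    Decidable (SixElements x y z) :=
  inferInstanceAs (Decidable (_ ∧ _))

/-- The generator of `ℤ_n`. -/
abbrev gen (n : ℕ) : Cyc n := Multiplicative.ofAdd 1

theorem card_cyc (n : ℕ) : Nat.card (Cyc n) = n := by
  rw [Nat.card_congr Multiplicative.toAdd, Nat.card_zmod]

/-- Here and in the six checks below, the triple consists of the products of one element of order 3
with the three involutions commuting with it. -/
theorem sixElements_two_six :
    SixElements ((1, gen 6) : Cyc 2 × Cyc 6) (gen 2, gen 6) (gen 2, gen 6 ^ 4) := by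
  decide +kernel

theorem sixElements_three_symm :
    SixElements ((gen 3, Equiv.swap 0 1) : Cyc 3 × Equiv.Perm (Fin 3)) (gen 3, Equiv.swap 0 2)
      (gen 3, Equiv.swap 1 2) := by
  decide +kernel

theorem sixElements_two_threeByFour :
    SixElements ((gen 2, SemidirectProduct.inl (gen 3)) : Cyc 2 × ThreeByFour)
      (1, ⟨gen 3, gen 4 ^ 2⟩) (gen 2, ⟨gen 3, gen 4 ^ 2⟩) := by
  decide +kernel

theorem sixElements_sixTwoByTwo :
    SixElements (⟨(gen 6, 1), 1⟩ : SixTwoByTwo) ⟨(gen 6, gen 2), 1⟩ ⟨(gen 6 ^ 4, gen 2), 1⟩ := by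
  decide +kernel

theorem sixElements_two_two_symm :
    SixElements ((1, gen 2, finRotate 3) : Cyc 2 × Cyc 2 × Equiv.Perm (Fin 3))
      (gen 2, 1, finRotate 3) (gen 2, gen 2, finRotate 3) := by
  decide +kernel

/-- The double transposition `(0 1)(2 3)`. -/
def doubleSwap : alternatingGroup (Fin 4) := 
  ⟨Equiv.swap 0 1 * Equiv.swap 2 3, Equiv.Perm.mem_alternatingGroup.2 (by decide)⟩

/-- The double transposition `(0 2)(1 3)`. -/
def doubleSwap' : alternatingGroup (Fin 4) := 
  ⟨Equiv.swap 0 2 * Equiv.swap 1 3, Equiv.Perm.mem_alternatingGroup.2 (by decide)⟩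

theorem sixElements_three_alt :
    SixElements ((gen 3, doubleSwap) : Cyc 3 × alternatingGroup (Fin 4)) (gen 3, doubleSwap')
      (gen 3, doubleSwap * doubleSwap') := by
  decide +kernel

theorem sixElements_threeAltByTwo :
    SixElements (⟨(gen 3, doubleSwap), 1⟩ : ThreeAltByTwo) ⟨(gen 3, doubleSwap'), 1⟩
      ⟨(gen 3, doubleSwap * doubleSwap'), 1⟩ := by
  decide +kernel

theorem hasInvariants_two_six : HasInvariants (Cyc 2 × Cyc 6) 12 {1, 2, 3, 6} :=
  sixElements_two_six.hasInvariants (by simp only [Nat.card_prod, card_cyc]) (by decide +kernel)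

theorem hasInvariants_three_symm :
    HasInvariants (Cyc 3 × Equiv.Perm (Fin 3)) 18 {1, 2, 3, 6} :=
  sixElements_three_symm.hasInvariants
    (by simp only [Nat.card_prod, card_cyc, Nat.card_perm, Nat.card_fin]; rfl) (by decide +kernel)

theorem hasInvariants_two_threeByFour :
    HasInvariants (Cyc 2 × ThreeByFour) 24 {1, 2, 3, 4, 6} :=
  sixElements_two_threeByFour.hasInvariants_of_orderFour
    (by simp only [Nat.card_prod, SemidirectProduct.card, card_cyc]) (by decide +kernel)
    (by decide +kernel)

theorem hasInvariants_sixTwoByTwo : HasInvariants SixTwoByTwo 24 {1, 2, 3, 4, 6} :=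
  sixElements_sixTwoByTwo.hasInvariants_of_orderFour
    (by simp only [Nat.card_prod, SemidirectProduct.card, card_cyc]) (by decide +kernel)
    (by decide +kernel)

theorem hasInvariants_two_two_symm :
    HasInvariants (Cyc 2 × Cyc 2 × Equiv.Perm (Fin 3)) 24 {1, 2, 3, 6} :=
  sixElements_two_two_symm.hasInvariants
    (by simp only [Nat.card_prod, card_cyc, Nat.card_perm, Nat.card_fin]; rfl) (by decide +kernel)

theorem card_alternatingGroup_four : Nat.card (alternatingGroup (Fin 4)) = 12 := by
  rw [nat_card_alternatingGroup]
  simp [Nat.factorial]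

theorem hasInvariants_three_alt :
    HasInvariants (Cyc 3 × alternatingGroup (Fin 4)) 36 {1, 2, 3, 6} :=
  sixElements_three_alt.hasInvariants
    (by simp only [Nat.card_prod, card_cyc, card_alternatingGroup_four]) (by decide +kernel)

theorem hasInvariants_threeAltByTwo : HasInvariants ThreeAltByTwo 72 {1, 2, 3, 4, 6} :=
  sixElements_threeAltByTwo.hasInvariants_of_orderFour
    (by simp only [Nat.card_prod, SemidirectProduct.card, card_cyc, card_alternatingGroup_four])
    (by decide +kernel) (by decide +kernel)

/-! ### The configuration forced by the hypothesis -/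

/-- The data forced on a group whose elements of order six are `t u`, `t v`, `t w` and their
inverses: elements of order three and two commute only when they are the evident ones. -/
structure SixData {G : Type*} [Group G] (t u v w : G) : Prop where
  t3 : t ^ 3 = 1
  t1 : t ≠ 1
  u2 : u ^ 2 = 1
  u1 : u ≠ 1
  v2 : v ^ 2 = 1
  v1 : v ≠ 1
  w2 : w ^ 2 = 1
  w1 : w ≠ 1
  huv : u ≠ v
  huw : u ≠ w
  hvw : v ≠ w
  tu : Commute t u
  tv : Commute t v
  tw : Commute t w
  pow : ∀ x : G, x ^ 4 = 1 ∨ x ^ 6 = 1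
  key : ∀ s z : G, s ^ 3 = 1 → s ≠ 1 → z ^ 2 = 1 → z ≠ 1 → Commute s z →
    (s = t ∨ s = t⁻¹) ∧ (z = u ∨ z = v ∨ z = w)

section
variable {G : Type*} [Group G] {t u v w : G}

theorem orderOf_mul_eq_six {s z : G} (hs3 : s ^ 3 = 1) (hs : s ≠ 1) (hz2 : z ^ 2 = 1)
    (hz : z ≠ 1) (h : Commute s z) : orderOf (s * z) = 6 := by
  have h1 : orderOf s = 3 := orderOf_eq_prime hs3 hs
  have h2 : orderOf z = 2 := orderOf_eq_prime hz2 hz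
  rw [h.orderOf_mul_eq_mul_orderOf_of_coprime (by rw [h1, h2]; decide), h1, h2]

/-- Cubes and fourth powers recover the two factors: 3 is 0 mod 3 and 1 mod 2, while 4 is 1 mod 3
and 0 mod 2. -/
theorem mul_pow_three {s z : G} (hs3 : s ^ 3 = 1) (hz2 : z ^ 2 = 1)
    (h : Commute s z) : (s * z) ^ 3 = z := by
  rw [h.mul_pow, hs3, one_mul, pow_succ, hz2, one_mul]

theorem mul_pow_four {s z : G} (hs3 : s ^ 3 = 1) (hz2 : z ^ 2 = 1)
    (h : Commute s z) : (s * z) ^ 4 = s := by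
  rw [h.mul_pow, pow_succ s, hs3, one_mul, pow_mul z 2 2, hz2, one_pow, mul_one]

/-- The subgroups generated by `t * u`, `t * v`, `t * w` are distinct, so they exhaust the three
available. Any commuting `s`, `z` as in `key` then give `s * z` equal to one of these products or
its inverse, and third and fourth powers separate the factors. -/
theorem sixData_of_ncard (hord : elementOrders G ⊆ {1, 2, 3, 4, 6})
    (hcard : (cyclicSubgroups G 6).ncard = 3)
    (t3 : t ^ 3 = 1) (t1 : t ≠ 1) (u2 : u ^ 2 = 1) (u1 : u ≠ 1) (v2 : v ^ 2 = 1) (v1 : v ≠ 1)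
    (w2 : w ^ 2 = 1) (w1 : w ≠ 1) (huv : u ≠ v) (huw : u ≠ w) (hvw : v ≠ w)
    (tu : Commute t u) (tv : Commute t v) (tw : Commute t w) : SixData t u v w := by
  have hne : ∀ {y z : G}, y ^ 2 = 1 → y ≠ 1 → z ^ 2 = 1 → z ≠ 1 → Commute t y → Commute t z →
      y ≠ z → Subgroup.zpowers (t * y) ≠ Subgroup.zpowers (t * z) := by
    intro y z y2 y1 z2 z1 hy hz hyz
    refine zpowers_ne_of_sq_eq (orderOf_mul_eq_six t3 t1 y2 y1 hy)
      (orderOf_mul_eq_six t3 t1 z2 z1 hz) ?_ fun h => hyz (mul_left_cancel h).symm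
    rw [hy.mul_pow, hz.mul_pow, y2, z2]
  have hsub : ({Subgroup.zpowers (t * u), Subgroup.zpowers (t * v), Subgroup.zpowers (t * w)} :
      Set (Subgroup G)) = cyclicSubgroups G 6 := by
    -- An infinite set has `ncard` zero, so the value 3 also supplies finiteness.
    refine Set.eq_of_subset_of_ncard_le ?_ ?_ (Set.finite_of_ncard_ne_zero (by omega))
    · rintro H (rfl | rfl | rfl)
      exacts [zpowers_mem_cyclicSubgroups (orderOf_mul_eq_six t3 t1 u2 u1 tu),
        zpowers_mem_cyclicSubgroups (orderOf_mul_eq_six t3 t1 v2 v1 tv),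
        zpowers_mem_cyclicSubgroups (orderOf_mul_eq_six t3 t1 w2 w1 tw)]
    · rw [hcard, Set.ncard_eq_three.2 ⟨_, _, _, hne u2 u1 v2 v1 tu tv huv,
        hne u2 u1 w2 w1 tu tw huw, hne v2 v1 w2 w1 tv tw hvw, rfl⟩]
  refine ⟨t3, t1, u2, u1, v2, v1, w2, w1, huv, huw, hvw, tu, tv, tw, fun x => ?_,
    fun s z s3 s1 z2 z1 hsz => ?_⟩
  · have hx := hord ⟨x, rfl⟩
    simp only [Set.mem_insert_iff, Set.mem_singleton_iff] at hx
    simp only [← orderOf_dvd_iff_pow_eq_one]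
    rcases hx with hx | hx | hx | hx | hx <;> rw [hx] <;> decide
  · have hm := zpowers_mem_cyclicSubgroups (orderOf_mul_eq_six s3 s1 z2 z1 hsz)
    have step : ∀ y : G, y ^ 2 = 1 → y ≠ 1 → Commute t y →
        Subgroup.zpowers (s * z) = Subgroup.zpowers (t * y) → (s = t ∨ s = t⁻¹) ∧ z = y := by
      intro y y2 y1 hy h
      have := (zpowers_eq_iff_of_orderOf_eq_six (orderOf_mul_eq_six t3 t1 y2 y1 hy)
        (orderOf_mul_eq_six s3 s1 z2 z1 hsz)).1 h.symm
      have hs := mul_pow_four s3 z2 hsz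
      have hz := mul_pow_three s3 z2 hsz
      rcases this with h | h <;> rw [h] at hs hz
      · rw [mul_pow_four t3 y2 hy] at hs
        rw [mul_pow_three t3 y2 hy] at hz
        exact ⟨Or.inl hs.symm, hz.symm⟩
      · rw [inv_pow, mul_pow_four t3 y2 hy] at hs
        rw [inv_pow, mul_pow_three t3 y2 hy, inv_eq_of_mul_eq_one_left (by rw [← sq, y2])] at hz
        exact ⟨Or.inr hs.symm, hz.symm⟩
    rw [← hsub] at hm
    rcases hm with h | h | h
    · exact (step u u2 u1 tu h).imp_right Or.inl
    · exact (step v v2 v1 tv h).imp_right (Or.inr ∘ Or.inl)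
    · exact (step w w2 w1 tw h).imp_right (Or.inr ∘ Or.inr)

theorem conj_eq_iff_commute {x y : G} : MulAut.conj x y = y ↔ Commute x y := by
  rw [MulAut.conj_apply, mul_inv_eq_iff_eq_mul]
  rfl

/-- A cyclic group of order 6 has one subgroup of order 3, so `x ^ 2` and `y ^ 2` generate the same
group. Take `t = x ^ 2`, `u = x ^ 3`, `v = y ^ 3`. -/
theorem exists_sixData (hord : elementOrders G ⊆ {1, 2, 3, 4, 6})
    (hcard : (cyclicSubgroups G 6).ncard = 3) {H K : Subgroup G} (hH : H ∈ cyclicSubgroups G 6)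
    (hK : K ∈ cyclicSubgroups G 6) (hHK : H ≠ K) (h3 : Nat.card (H ⊓ K : Subgroup G) = 3) :
    ∃ t u v : G, (Commute u v ∧ SixData t u v (u * v)) ∨
      (¬ Commute u v ∧ SixData t u v (u * v * u)) := by
  obtain ⟨x, hx, rfl⟩ := exists_generator hH
  obtain ⟨y, hy, rfl⟩ := exists_generator hK
  set L := Subgroup.zpowers x ⊓ Subgroup.zpowers y with hL
  have hgen : ∀ {z : G}, orderOf z = 6 → L ≤ Subgroup.zpowers z →
      L = Subgroup.zpowers (z ^ 2) := by
    intro z hz hle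
    have hfin : Finite L := Nat.finite_of_card_ne_zero (by omega)
    have hz3 : Nat.card (Subgroup.zpowers (z ^ 2)) = 3 := by
      rw [Nat.card_zpowers, orderOf_pow' z two_ne_zero, hz]; rfl
    have hfz : Finite (Subgroup.zpowers (z ^ 2)) := Nat.finite_of_card_ne_zero (by omega)
    refine Subgroup.eq_of_le_of_card_ge (fun g hg => ?_) (by omega)
    have hg3 : g ^ 3 = 1 := by
      have := pow_card_eq_one' (x := (⟨g, hg⟩ : L))
      rw [h3] at this
      simpa using congrArg Subtype.val this
    obtain ⟨k, rfl⟩ := hle hg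
    simp only [] at hg3 ⊢
    rw [← zpow_natCast, ← zpow_mul, ← orderOf_dvd_iff_zpow_eq_one, hz] at hg3
    -- The cube of `z ^ k` is trivial, so 6 divides `3 * k`.
    obtain ⟨m, hm⟩ : (2 : ℤ) ∣ k := by
      push_cast at hg3
      omega
    exact ⟨m, by simp only [hm, zpow_mul, zpow_ofNat]⟩
  have hx2 := hgen hx inf_le_left
  have hy2 := hgen hy inf_le_right
  obtain ⟨x6, x2, x3⟩ := (orderOf_eq_six_iff x).1 hx
  obtain ⟨y6, y2, y3⟩ := (orderOf_eq_six_iff y).1 hy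
  have hcomm : Commute (x ^ 2) (y ^ 3) := by
    have : x ^ 2 ∈ Subgroup.zpowers (y ^ 2) := by
      rw [← hy2, hx2]; exact Subgroup.mem_zpowers _
    obtain ⟨k, hk⟩ := this
    rw [← hk]
    exact ((Commute.refl y).pow_pow 2 3).zpow_left k
  have hu2 : (x ^ 3) ^ 2 = 1 := by rw [← pow_mul, x6]
  have hv2 : (y ^ 3) ^ 2 = 1 := by rw [← pow_mul, y6]
  have ht3 : (x ^ 2) ^ 3 = 1 := by rw [← pow_mul, x6]
  have htu : Commute (x ^ 2) (x ^ 3) := (Commute.refl x).pow_pow 2 3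
  -- Since `a = a ^ 3 * (a ^ 2)⁻¹`, equal cubes together with equal groups of squares would make the
  -- two subgroups equal.
  have huv : x ^ 3 ≠ y ^ 3 := by
    intro h
    apply hHK
    have gen_le : ∀ {a b : G}, a ^ 3 = b ^ 3 → Subgroup.zpowers (a ^ 2) = Subgroup.zpowers (b ^ 2) →
        Subgroup.zpowers a ≤ Subgroup.zpowers b := by
      intro a b hab hab2
      rw [Subgroup.zpowers_le]
      have h2 : a ^ 2 ∈ Subgroup.zpowers b := by
        have : a ^ 2 ∈ Subgroup.zpowers (b ^ 2) := hab2 ▸ Subgroup.mem_zpowers _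
        exact (Subgroup.zpowers_le.2 (Subgroup.npow_mem_zpowers b 2)) this
      have h3 : a ^ 3 ∈ Subgroup.zpowers b := hab ▸ Subgroup.npow_mem_zpowers b 3
      have : a = a ^ 3 * (a ^ 2)⁻¹ := by rw [eq_mul_inv_iff_mul_eq, ← pow_succ']
      rw [this]
      exact mul_mem h3 (inv_mem h2)
    exact le_antisymm (gen_le h (hx2 ▸ hy2)) (gen_le h.symm (hy2 ▸ hx2))
  generalize hu : x ^ 3 = u at *
  generalize hv : y ^ 3 = v at *
  generalize ht : x ^ 2 = t at *
  have hui : u⁻¹ = u := inv_eq_of_mul_eq_one_left (by rw [← sq, hu2])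
  have hvi : v⁻¹ = v := inv_eq_of_mul_eq_one_left (by rw [← sq, hv2])
  refine ⟨t, u, v, ?_⟩
  by_cases hc : Commute u v
  · refine Or.inl ⟨hc, sixData_of_ncard hord hcard ht3 x2 hu2 x3 hv2 y3 ?_ ?_ huv ?_ ?_ htu hcomm
      (htu.mul_right hcomm)⟩
    · rw [hc.mul_pow, hu2, hv2, one_mul]
    · rwa [ne_eq, ← eq_inv_iff_mul_eq_one, hvi]
    · simpa using y3
    · simpa using x3
  · have hconj : u * v * u = MulAut.conj u v := by rw [MulAut.conj_apply, hui]
    refine Or.inr ⟨hc, sixData_of_ncard hord hcard ht3 x2 hu2 x3 hv2 y3 ?_ ?_ huv ?_ ?_ htu hcomm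
      ((htu.mul_right hcomm).mul_right htu)⟩
    · rw [hconj, ← map_pow, hv2, map_one]
    · rw [hconj]
      simpa using y3
    · intro h
      rw [right_eq_mul, ← eq_inv_iff_mul_eq_one, hvi] at h
      exact huv h
    · rw [hconj]
      intro h
      exact hc (conj_eq_iff_commute.1 h.symm)

end

/-! ### Conjugation on `t` and on the three involutions -/

section
variable {G : Type*} [Group G] {t u v w : G}

theorem mulAut_conj_pow (x : G) (n : ℕ) (y : G) :
    MulAut.conj (x ^ n) y = (MulAut.conj x)^[n] y := by
  induction n with
  | zero => simp
  | succ n ih =>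
    rw [pow_succ', map_mul, MulAut.mul_apply, ih, Function.iterate_succ_apply']

theorem conj_mul_apply (x y z : G) :
    MulAut.conj (x * y) z = MulAut.conj x (MulAut.conj y z) := by
  rw [map_mul, MulAut.mul_apply]

theorem conj_mul_eq {g c x : G} (hc : Commute c x) :
    MulAut.conj (g * c) x = MulAut.conj g x := by
  rw [conj_mul_apply, conj_eq_iff_commute.2 hc]

theorem mul_sq_eq (g c : G) : (g * c) ^ 2 = MulAut.conj g c * g ^ 2 * c := by
  simp [sq, mul_assoc]

namespace SixData

/-- Conjugation carries a commuting pair `t`, `z` to another such pair, to which `key` applies. -/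
theorem conj_mem (h : SixData t u v w) (g : G) {z : G} (hz : z = u ∨ z = v ∨ z = w) :
    (MulAut.conj g t = t ∨ MulAut.conj g t = t⁻¹) ∧
      (MulAut.conj g z = u ∨ MulAut.conj g z = v ∨ MulAut.conj g z = w) := by
  have aux : ∀ y : G, y ^ 2 = 1 → y ≠ 1 → Commute t y →
      (MulAut.conj g t = t ∨ MulAut.conj g t = t⁻¹) ∧
      (MulAut.conj g y = u ∨ MulAut.conj g y = v ∨ MulAut.conj g y = w) := by
    intro y y2 y1 hy
    refine h.key _ _ ?_ ?_ ?_ ?_ (hy.map (MulAut.conj g))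
    · rw [← map_pow, h.t3, map_one]
    · simpa using h.t1
    · rw [← map_pow, y2, map_one]
    · simpa using y1
  rcases hz with rfl | rfl | rfl
  exacts [aux _ h.u2 h.u1 h.tu, aux _ h.v2 h.v1 h.tv, aux _ h.w2 h.w1 h.tw]

theorem conj_eq_inv (h : SixData t u v w) {g : G} (hg : ¬ Commute g t) :
    MulAut.conj g t = t⁻¹ :=
  (h.conj_mem g (Or.inl rfl)).1.resolve_left fun h' => hg (conj_eq_iff_commute.1 h')

/-- Two inversions of `t` cancel: the centralizer of `t` has index at most 2. -/
theorem commute_mul (h : SixData t u v w) {g k : G} (hg : ¬ Commute g t) (hk : ¬ Commute k t) :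
    Commute (g * k) t := by
  rw [← conj_eq_iff_commute, conj_mul_apply, h.conj_eq_inv hk, map_inv, h.conj_eq_inv hg, inv_inv]

theorem commute_mul_iff {g c : G} (hc : Commute c t) :
    Commute (g * c) t ↔ Commute g t := by
  rw [← conj_eq_iff_commute, conj_mul_apply, conj_eq_iff_commute.2 hc, conj_eq_iff_commute]

theorem mem_of_commute (h : SixData t u v w) {z : G} (hz : Commute z t) (z2 : z ^ 2 = 1)
    (z1 : z ≠ 1) : z = u ∨ z = v ∨ z = w :=
  (h.key t z h.t3 h.t1 z2 z1 hz.symm).2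

theorem eq_one_or (h : SixData t u v w) {s z : G} (s3 : s ^ 3 = 1) (z2 : z ^ 2 = 1)
    (z1 : z ≠ 1) (hsz : Commute s z) : s = 1 ∨ s = t ∨ s = t⁻¹ := by
  by_cases hs : s = 1
  · exact Or.inl hs
  · exact Or.inr (h.key s z s3 hs z2 z1 hsz).1

theorem exists_pow (h : SixData t u v w) {s z : G} (s3 : s ^ 3 = 1) (z2 : z ^ 2 = 1)
    (z1 : z ≠ 1) (hsz : Commute s z) : ∃ k : ℕ, s = t ^ k := by
  rcases h.eq_one_or s3 z2 z1 hsz with rfl | rfl | rfl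
  · exact ⟨0, by simp⟩
  · exact ⟨1, by simp⟩
  · exact ⟨2, by rw [inv_eq_iff_mul_eq_one, ← pow_succ', h.t3]⟩

/-- An element of order 4 commuting with `t` would give one of order 12. -/
theorem pow_six_of_commute (h : SixData t u v w) {x : G} (hx : Commute x t) : x ^ 6 = 1 := by
  refine (h.pow x).elim (fun h4 => ?_) id
  rcases h.pow (x * t) with h' | h'
  · rw [hx.mul_pow, h4, one_mul, pow_succ, h.t3, one_mul] at h'
    exact absurd h' h.t1
  · rwa [hx.mul_pow, pow_mul t 3 2, h.t3, one_pow, mul_one] at h'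

/-- If `g` had order 3, it would be a power of `g ^ 2`, which centralizes `t`. If it had order 6,
then `key` would make `g ^ 2` equal to `t` or `t⁻¹`. Either way `g` would commute with `t`. -/
theorem pow_four_of_not_commute (h : SixData t u v w) {g : G} (hg : ¬ Commute g t) :
    g ^ 4 = 1 := by
  refine (h.pow g).elim id fun h6 => ?_
  by_cases h2 : g ^ 2 = 1
  · rw [pow_mul g 2 2, h2, one_pow]
  by_cases h3 : g ^ 3 = 1
  · refine absurd ?_ hg
    have hc : Commute (g ^ 4) t := by
      rw [pow_mul g 2 2, sq g]
      exact (h.commute_mul hg hg).pow_left 2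
    rwa [pow_succ, h3, one_mul] at hc
  · have := (h.key (g ^ 2) (g ^ 3) (by rw [← pow_mul, h6]) h2 (by rw [← pow_mul, h6]) h3
      ((Commute.refl g).pow_pow 2 3)).1
    refine absurd ?_ hg
    have hc : Commute g (g ^ 2) := (Commute.refl g).pow_right 2
    rcases this with h' | h' <;> rw [h'] at hc
    exacts [hc, by simpa using hc.inv_right]

end SixData

theorem inv_eq_self_of_sq {z : G} (hz : z ^ 2 = 1) : z⁻¹ = z :=
  inv_eq_of_mul_eq_one_left (by rw [← sq, hz])

theorem conj_eq_of_sq {z : G} (hz : z ^ 2 = 1) (x : G) : MulAut.conj z x = z * x * z := by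
  rw [MulAut.conj_apply, inv_eq_self_of_sq hz]

theorem sq_invThree : invThree ^ 2 = 1 := by
  ext x; revert x; decide

/-! ### The dihedral group of order six and the noncommuting case -/

/-- The dihedral group of order six as a semidirect product. -/
abbrev DihSix : Type := Cyc 3 ⋊[cyclicAction 2 invThree sq_invThree] Cyc 2

/-- The homomorphism from the dihedral group of order six given by elements `r` and `u` with
`u` inverting `r`. -/
def dihHom {r u : G} (r3 : r ^ 3 = 1) (u2 : u ^ 2 = 1) (hur : MulAut.conj u r = r⁻¹) :
    DihSix →* G :=
  cyclicLift sq_invThree (cycHom 3 r r3) u u2 (by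
    intro x
    refine (map_inv (cycHom 3 r r3) x).trans ?_
    rw [← MulAut.conj_apply, cycHom_apply, map_pow, hur, inv_pow])

theorem dihHom_apply {r u : G} {r3 : r ^ 3 = 1} {u2 : u ^ 2 = 1} {hur : MulAut.conj u r = r⁻¹}
    (x : DihSix) : ∃ i j : ℕ, j < 2 ∧ dihHom r3 u2 hur x = r ^ i * u ^ j :=
  ⟨_, _, ZMod.val_lt _, rfl⟩

theorem pow_ne_one_of_prime {n : ℕ} (hn : n.Prime) {g : G} (hg : g ^ n = 1) (h1 : g ≠ 1) :
    ∀ d, 0 < d → d < n → g ^ d ≠ 1 := by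
  intro d h0 hd h
  have : Fact n.Prime := ⟨hn⟩
  have ho := orderOf_eq_prime hg h1
  have := Nat.le_of_dvd h0 (orderOf_dvd_of_pow_eq_one h)
  omega

theorem dihHom_injective {r u : G} {r3 : r ^ 3 = 1} {u2 : u ^ 2 = 1}
    {hur : MulAut.conj u r = r⁻¹} (hr : r ≠ 1) (hu : u ≠ 1) :
    Function.Injective (dihHom r3 u2 hur) := by
  refine cyclicLift_injective (cycHom_injective (pow_ne_one_of_prime Nat.prime_three r3 hr)) ?_
  rintro d h0 h2 ⟨x, hx⟩
  obtain rfl : d = 1 := by omega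
  rw [pow_one, cycHom_apply] at hx
  apply hu
  have h3 : u ^ 3 = 1 := by rw [← hx, ← pow_mul, mul_comm, pow_mul, r3, one_pow]
  rwa [pow_succ, u2, one_mul] at h3

theorem exists_dihHom {r u : G} {r3 : r ^ 3 = 1} {u2 : u ^ 2 = 1}
    {hur : MulAut.conj u r = r⁻¹} (i j : ℕ) : ∃ x, dihHom r3 u2 hur x = r ^ i * u ^ j :=
  ⟨⟨Multiplicative.ofAdd (i : ZMod 3), Multiplicative.ofAdd (j : ZMod 2)⟩, by
    rw [pow_eq_pow_mod i r3, pow_eq_pow_mod j u2, ← ZMod.val_natCast, ← ZMod.val_natCast]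
    rfl⟩

/-- The dihedral group of order six is the symmetric group on three letters. -/
noncomputable def dihEquivPerm : DihSix ≃* Equiv.Perm (Fin 3) :=
  MulEquiv.ofBijective (dihHom (r := finRotate 3) (u := Equiv.swap 0 1)
    (by decide) (by decide) (by decide)) (by decide +kernel)

namespace SixData

variable (h : SixData t u v w)

include h

/-- The dihedral group generated by `u` and `v` realizes all permutations of the involutions, so
everything reduces to showing that the kernel of this action is generated by `t`. -/
theorem nonempty_mulEquiv_of_not_commute (hw : w = u * v * u) (huv : ¬ Commute u v) :
    Nonempty (G ≃* Cyc 3 × Equiv.Perm (Fin 3)) := by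
  have hui := inv_eq_self_of_sq h.u2
  have hvi := inv_eq_self_of_sq h.v2
  have uu : u * u = 1 := by rw [← sq, h.u2]
  have vv : v * v = 1 := by rw [← sq, h.v2]
  have uv : MulAut.conj u v = w := by rw [conj_eq_of_sq h.u2, hw]
  have uw : MulAut.conj u w = v := by
    rw [← uv, ← conj_mul_apply, uu, map_one, MulAut.one_apply]
  have vu : MulAut.conj v u = w := by
    rcases (h.conj_mem v (Or.inl rfl)).2 with h' | h' | h'
    · exact absurd (conj_eq_iff_commute.1 h').symm huv
    · exact absurd ((MulAut.conj v).injective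
        (h'.trans (conj_eq_iff_commute.2 (Commute.refl v)).symm)) h.huv
    · exact h'
  have vw : MulAut.conj v w = u := by
    rw [← vu, ← conj_mul_apply, vv, map_one, MulAut.one_apply]
  have uu' : MulAut.conj u u = u := conj_eq_iff_commute.2 (Commute.refl u)
  have vv' : MulAut.conj v v = v := conj_eq_iff_commute.2 (Commute.refl v)
  -- Both `u * v * u` and `v * u * v` equal `w`, so the cube is `w ^ 2`.
  have hr3 : (u * v) ^ 3 = 1 := by
    have h1 : (u * v) ^ 3 = (u * v * u) * (v * u * v) := by
      simp only [pow_succ, pow_zero, one_mul, mul_assoc]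
    rw [h1, ← conj_eq_of_sq h.v2, vu, ← hw, ← sq, h.w2]
  have hur : MulAut.conj u (u * v) = (u * v)⁻¹ := by
    rw [conj_eq_of_sq h.u2, mul_inv_rev, hui, hvi, ← mul_assoc, uu, one_mul]
  have hr1 : u * v ≠ 1 := by
    rw [ne_eq, ← eq_inv_iff_mul_eq_one, hvi]
    exact h.huv
  -- a representative of each class modulo the kernel of the action on the involutions
  have hrep : ∀ g : G, ∃ i j : ℕ, MulAut.conj g u = MulAut.conj ((u * v) ^ i * u ^ j) u ∧
      MulAut.conj g v = MulAut.conj ((u * v) ^ i * u ^ j) v := by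
    intro g
    have hinj : MulAut.conj g u ≠ MulAut.conj g v := (MulAut.conj g).injective.ne h.huv
    rcases (h.conj_mem g (Or.inl rfl)).2 with h1 | h1 | h1 <;>
    rcases (h.conj_mem g (Or.inr (Or.inl rfl))).2 with h2 | h2 | h2 <;>
    rw [h1, h2] at hinj ⊢ <;> try exact absurd rfl hinj
    · exact ⟨0, 0, by simp, by simp⟩
    · exact ⟨0, 1, by simp [uu', -MulAut.conj_apply], by simp [uv, -MulAut.conj_apply]⟩
    · exact ⟨1, 1, by simp [uu', uw, vu, -MulAut.conj_apply],
        by simp [uv, vw, uu', -MulAut.conj_apply]⟩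
    · exact ⟨1, 0, by simp [uw, vu, -MulAut.conj_apply],
        by simp [uv, vv', -MulAut.conj_apply]⟩
    · exact ⟨2, 0, by simp [sq, uv, uw, vu, vv', -MulAut.conj_apply],
        by simp [sq, uv, vw, uu', vv', -MulAut.conj_apply]⟩
    · exact ⟨2, 1, by simp [sq, uv, uw, vu, vv', uu', -MulAut.conj_apply],
        by simp [sq, uv, vw, uu', uw, vu, -MulAut.conj_apply]⟩
  -- A nontrivial cube of `y` would be one of `u`, `v`, `w`, but none of these commutes with both
  -- `u` and `v`.
  have hker : ∀ y : G, Commute y t → Commute y u → Commute y v → ∃ k : ℕ, y = t ^ k := by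
    intro y hyt hyu hyv
    have y6 := h.pow_six_of_commute hyt
    by_cases y3 : y ^ 3 = 1
    · exact h.exists_pow y3 h.u2 h.u1 hyu
    · exfalso
      have hzu := hyu.pow_left 3
      have hzv := hyv.pow_left 3
      rcases h.mem_of_commute (hyt.pow_left 3) (by rw [← pow_mul, y6]) y3 with hz | hz | hz <;>
      rw [hz] at hzu hzv
      · exact huv hzv
      · exact huv hzu.symm
      · rw [conj_eq_iff_commute.2 hzu.symm] at uw
        exact h.hvw uw.symm
  have hct : ∀ i j : ℕ, Commute ((u * v) ^ i * u ^ j) t := fun i j =>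
    (((h.tu.mul_right h.tv).pow_right i).mul_right (h.tu.pow_right j)).symm
  have hall : ∀ g : G, ∃ k i j : ℕ, g = t ^ k * ((u * v) ^ i * u ^ j) := by
    intro g
    obtain ⟨i, j, hu, hv⟩ := hrep g
    have hc := hct i j
    generalize hcdef : (u * v) ^ i * u ^ j = c at *
    have hyu : Commute (c⁻¹ * g) u := by
      rw [← conj_eq_iff_commute, conj_mul_apply, hu, ← conj_mul_apply]
      simp
    have hyv : Commute (c⁻¹ * g) v := by
      rw [← conj_eq_iff_commute, conj_mul_apply, hv, ← conj_mul_apply]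
      simp
    have hfin : ∀ k : ℕ, c⁻¹ * g = t ^ k → g = t ^ k * c := by
      intro k hk
      rw [← (hc.pow_right k).eq, ← hk, mul_inv_cancel_left]
    by_cases hyt : Commute (c⁻¹ * g) t
    · obtain ⟨k, hk⟩ := hker _ hyt hyu hyv
      exact ⟨k, i, j, by rw [hcdef]; exact hfin k hk⟩
    · exfalso
      generalize c⁻¹ * g = y at *
      -- Off the centralizer of `t`, such a `y` would be an involution commuting with `u * v`, of
      -- order 3. Then `key` would make `u * v` equal to `t` or `t⁻¹`, so it would commute with `u`,
      -- and so would `v`.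
      have y4 := h.pow_four_of_not_commute hyt
      obtain ⟨k, hk⟩ := hker (y ^ 2) (by rw [sq]; exact h.commute_mul hyt hyt)
        (hyu.pow_left 2) (hyv.pow_left 2)
      have y2 : y ^ 2 = 1 := by
        have : (y ^ 2) ^ 3 = 1 := by rw [hk, ← pow_mul, mul_comm, pow_mul, h.t3, one_pow]
        rwa [← pow_mul, pow_add y 4 2, y4, one_mul] at this
      have y1 : y ≠ 1 := by
        rintro rfl
        exact hyt (Commute.one_left t)
      have hrt := (h.key (u * v) y hr3 hr1 y2 y1 (hyu.mul_right hyv).symm).1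
      have hcr : Commute (u * v) u := by
        rcases hrt with h' | h' <;> rw [h']
        exacts [h.tu, h.tu.inv_left]
      apply huv
      have := hcr.eq
      rw [mul_assoc, mul_right_inj] at this
      exact this.symm
  refine ⟨(MulEquiv.ofBijective (cycProd 3 t h.t3 (dihHom hr3 h.u2 hur) fun x => ?_)
    (cycProd_bijective (dihHom_injective hr1 h.u1) ?_ ?_)).symm.trans
      ((MulEquiv.refl _).prodCongr dihEquivPerm)⟩
  · obtain ⟨i, j, -, hx⟩ := dihHom_apply (r3 := hr3) (u2 := h.u2) (hur := hur) x
    rw [hx]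
    exact (hct i j).symm
  · rintro d h0 h3 ⟨x, hx⟩
    refine pow_ne_one_of_prime Nat.prime_three h.t3 h.t1 d h0 h3 ?_
    have hy3 : (t ^ d) ^ 3 = 1 := by rw [← pow_mul, mul_comm, pow_mul, h.t3, one_pow]
    have hyu : MulAut.conj u (t ^ d) = t ^ d := conj_eq_iff_commute.2 (h.tu.pow_left d).symm
    obtain ⟨i, j, hj, hx'⟩ := dihHom_apply (r3 := hr3) (u2 := h.u2) (hur := hur) x
    rw [hx] at hx'
    have hri : MulAut.conj u ((u * v) ^ i) = ((u * v) ^ i)⁻¹ := by rw [map_pow, hur, inv_pow]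
    -- As a rotation, `t ^ d` is both fixed and inverted by `u`; as a reflection it squares to 1
    -- anyway.
    have hy2 : (t ^ d) ^ 2 = 1 := by
      interval_cases j
      · rw [pow_zero, mul_one] at hx'
        rw [hx', hri, ← hx'] at hyu
        rw [sq, ← eq_inv_iff_mul_eq_one, hyu]
      · rw [conj_eq_of_sq h.u2] at hri
        rw [hx', pow_one, sq, ← mul_assoc, mul_assoc _ u, mul_assoc _ _ u, hri, mul_inv_cancel]
    rwa [pow_succ, hy2, one_mul] at hy3
  · intro y
    obtain ⟨k, i, j, rfl⟩ := hall y
    obtain ⟨x, hx⟩ := exists_dihHom (r3 := hr3) (u2 := h.u2) (hur := hur) i j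
    exact ⟨x, k, by rw [hx]⟩

end SixData
end

theorem cyc_hom_ext {G : Type*} [Group G] {n : ℕ} [NeZero n] {f g : Cyc n →* G}
    (h : f (gen n) = g (gen n)) : f = g := by
  refine MonoidHom.ext fun x => ?_
  have hx : x = gen n ^ ZMod.val (n := n) (Multiplicative.toAdd x) := by
    rw [← ofAdd_nsmul, nsmul_one, ZMod.natCast_zmod_val]
    rfl
  rw [hx, map_pow, map_pow, h]

/-! ### Commuting involutions: the action on the Klein four group -/

/-- An element `t` of order three such that the involutions commuting with `t` are `a`, `b` and
`a b`, where `a` and `b` commute. -/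
structure KleinData {G : Type*} [Group G] (t a b : G) : Prop where
  six : SixData t a b (a * b)
  comm : Commute a b

namespace KleinData
variable {G : Type*} [Group G] {t a b : G}

section
variable (h : KleinData t a b)
include h

theorem aa : a * a = 1 := by rw [← sq, h.six.u2]
theorem bb : b * b = 1 := by rw [← sq, h.six.v2]
theorem ba : b * a = a * b := h.comm.eq.symm
theorem a_ab : a * (a * b) = b := by rw [← mul_assoc, h.aa, one_mul]
theorem b_ab : b * (a * b) = a := by rw [← h.ba, ← mul_assoc, h.bb, one_mul]
theorem ab_a : a * b * a = b := by rw [mul_assoc, h.ba, h.a_ab]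
theorem ab_b : a * b * b = a := by rw [mul_assoc, h.bb, mul_one]

/-- Together with `shear`, this reaches every ordered pair of distinct involutions among `a`, `b`,
`a * b`, so any of them may play the role of `a`. -/
theorem swap : KleinData t b a := by
  have h6 := h.six
  refine ⟨?_, h.comm.symm⟩
  rw [h.ba]
  exact ⟨h6.t3, h6.t1, h6.v2, h6.v1, h6.u2, h6.u1, h6.w2, h6.w1, h6.huv.symm, h6.hvw, h6.huw,
    h6.tv, h6.tu, h6.tw, h6.pow, fun s z s3 s1 z2 z1 hsz => by
      have := h6.key s z s3 s1 z2 z1 hsz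
      tauto⟩

theorem shear : KleinData t a (a * b) := by
  have h6 := h.six
  refine ⟨?_, (Commute.refl a).mul_right h.comm⟩
  rw [h.a_ab]
  exact ⟨h6.t3, h6.t1, h6.u2, h6.u1, h6.w2, h6.w1, h6.v2, h6.v1, h6.huw, h6.huv, h6.hvw.symm,
    h6.tu, h6.tw, h6.tv, h6.pow, fun s z s3 s1 z2 z1 hsz => by
      have := h6.key s z s3 s1 z2 z1 hsz
      tauto⟩

/-- Split `y = y ^ 4 * y ^ 3`. The first factor has trivial cube and commutes with `a`, so it is a
power of `t`; the second is 1 or an involution centralizing `t`. -/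
theorem exists_of_centralizes {y : G} (hyt : Commute y t) (hya : Commute y a) :
    ∃ k i j : ℕ, y = t ^ k * (a ^ i * b ^ j) := by
  have y6 := h.six.pow_six_of_commute hyt
  have hz2 : (y ^ 3) ^ 2 = 1 := by rw [← pow_mul, y6]
  obtain ⟨k, hk⟩ := h.six.exists_pow (s := y ^ 4)
    (by rw [← pow_mul, pow_mul y 6 2, y6, one_pow]) h.six.u2 h.six.u1 (hya.pow_left 4)
  have hy : y = y ^ 4 * y ^ 3 := by rw [← pow_add, pow_succ y 6, y6, one_mul]
  have hz : ∃ i j : ℕ, y ^ 3 = a ^ i * b ^ j := by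
    by_cases hy3 : y ^ 3 = 1
    · exact ⟨0, 0, by simpa using hy3⟩
    · rcases h.six.mem_of_commute (hyt.pow_left 3) hz2 hy3 with hz | hz | hz <;> rw [hz]
      exacts [⟨1, 0, by simp⟩, ⟨0, 1, by simp⟩, ⟨1, 1, by simp⟩]
  obtain ⟨i, j, hij⟩ := hz
  exact ⟨k, i, j, by rw [← hk, ← hij, ← hy]⟩

theorem conj_cases (g : G) :
    (MulAut.conj g a = a ∧ MulAut.conj g b = b) ∨ (MulAut.conj g a = a ∧ MulAut.conj g b = a * b) ∨
    (MulAut.conj g a = b ∧ MulAut.conj g b = a) ∨ (MulAut.conj g a = b ∧ MulAut.conj g b = a * b) ∨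
    (MulAut.conj g a = a * b ∧ MulAut.conj g b = a) ∨
    (MulAut.conj g a = a * b ∧ MulAut.conj g b = b) := by
  have hinj : MulAut.conj g a ≠ MulAut.conj g b := (MulAut.conj g).injective.ne h.six.huv
  have h1 := (h.six.conj_mem g (Or.inl rfl)).2
  have h2 := (h.six.conj_mem g (Or.inr (Or.inl rfl))).2
  rcases h1 with h1 | h1 | h1 <;> rcases h2 with h2 | h2 | h2 <;>
    rw [h1, h2] at hinj ⊢ <;> simp at hinj ⊢

/-- The cube of `x` lies in the abelian group {1, a, b, ab}, hence acts trivially on it; this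
excludes transpositions. -/
theorem inner_cases {x : G} (hx : Commute x t) :
    (Commute x a ∧ Commute x b) ∨ (MulAut.conj x a = a * b ∧ MulAut.conj x b = a) ∨
      (MulAut.conj x a = b ∧ MulAut.conj x b = a * b) := by
  have x6 := h.six.pow_six_of_commute hx
  have hz : Commute (x ^ 3) a ∧ Commute (x ^ 3) b := by
    by_cases hx3 : x ^ 3 = 1
    · rw [hx3]
      exact ⟨Commute.one_left a, Commute.one_left b⟩
    · rcases h.six.mem_of_commute (hx.pow_left 3) (by rw [← pow_mul, x6]) hx3 with hz | hz | hz <;>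
      rw [hz]
      exacts [⟨Commute.refl a, h.comm⟩, ⟨h.comm.symm, Commute.refl b⟩,
        ⟨(Commute.refl a).mul_left h.comm.symm, h.comm.mul_left (Commute.refl b)⟩]
  rw [← conj_eq_iff_commute, ← conj_eq_iff_commute, mulAut_conj_pow, mulAut_conj_pow] at hz
  simp only [Function.iterate_succ, Function.iterate_zero, Function.comp_apply, id] at hz
  obtain ⟨hza, hzb⟩ := hz
  rw [← conj_eq_iff_commute, ← conj_eq_iff_commute]
  rcases h.conj_cases x with h' | ⟨h1, h2⟩ | ⟨h1, h2⟩ | h' | h' | ⟨h1, h2⟩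
  · exact Or.inl h'
  · simp only [h1, h2, map_mul, h.a_ab] at hzb
    exact absurd hzb.symm h.six.hvw
  · simp only [h1, h2] at hza
    exact absurd hza.symm h.six.huv
  · exact Or.inr (Or.inr h')
  · exact Or.inr (Or.inl h')
  · simp only [h1, h2, map_mul, h.ab_b] at hza
    exact absurd hza.symm h.six.huw

/-- Here `g ^ 4 = 1` excludes 3-cycles, and for a transposition `a'` is chosen as the fixed
involution. -/
theorem outer_cases {g : G} (hg : ¬ Commute g t) : (Commute g a ∧ Commute g b) ∨
    ∃ a' b' : G, KleinData t a' b' ∧ MulAut.conj g a' = a' ∧ MulAut.conj g b' = a' * b' := by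
  have hz : MulAut.conj (g ^ 4) a = a := by
    rw [h.six.pow_four_of_not_commute hg, map_one, MulAut.one_apply]
  rw [mulAut_conj_pow] at hz
  simp only [Function.iterate_succ, Function.iterate_zero, Function.comp_apply, id] at hz
  rw [← conj_eq_iff_commute, ← conj_eq_iff_commute]
  rcases h.conj_cases g with h' | h' | ⟨h1, h2⟩ | ⟨h1, h2⟩ | ⟨h1, h2⟩ | ⟨h1, h2⟩
  · exact Or.inl h'
  · exact Or.inr ⟨a, b, h, h'⟩
  · refine Or.inr ⟨a * b, a, ?_, by rw [map_mul, h1, h2, h.ba], by rw [h1, h.ab_a]⟩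
    exact h.shear.swap
  · simp only [h1, h2, map_mul, h.b_ab] at hz
    exact absurd hz.symm h.six.huv
  · simp only [h1, h2, map_mul, h.ab_a] at hz
    exact absurd hz.symm h.six.huw
  · exact Or.inr ⟨b, a, h.swap, h2, by rw [h1, h.ba]⟩

/-- An element acting as a 3-cycle is replaced by its fourth power or its square, according to its
orientation; both have trivial cube. -/
theorem exists_rotation {x : G} (hx : Commute x t) (hn : ¬ (Commute x a ∧ Commute x b)) :
    ∃ s : G, s ^ 3 = 1 ∧ Commute s t ∧ MulAut.conj s a = a * b ∧ MulAut.conj s b = a := by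
  have x6 := h.six.pow_six_of_commute hx
  rcases (h.inner_cases hx).resolve_left hn with ⟨h1, h2⟩ | ⟨h1, h2⟩
  · refine ⟨x ^ 4, by rw [← pow_mul, pow_mul x 6 2, x6, one_pow], hx.pow_left 4, ?_, ?_⟩ <;>
    rw [mulAut_conj_pow] <;>
    simp only [Function.iterate_succ, Function.iterate_zero, Function.comp_apply, id, h1, h2,
      map_mul, h.ab_a]
  · refine ⟨x ^ 2, by rw [← pow_mul, x6], hx.pow_left 2, ?_, ?_⟩ <;>
    rw [mulAut_conj_pow] <;>
    simp only [Function.iterate_succ, Function.iterate_zero, Function.comp_apply, id, h1, h2,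
      map_mul, h.b_ab]

/-- Multiplying `x` by a suitable power of `s` makes it centralize `a`. -/
theorem exists_of_rotation {s : G} (s3 : s ^ 3 = 1) (hst : Commute s t)
    (hsa : MulAut.conj s a = a * b) (hsb : MulAut.conj s b = a) {x : G} (hx : Commute x t) :
    ∃ k i j l : ℕ, x = t ^ k * (a ^ i * b ^ j * s ^ l) := by
  have step : ∀ m l : ℕ, m + l = 3 → Commute (x * s ^ m) a →
      ∃ k i j l : ℕ, x = t ^ k * (a ^ i * b ^ j * s ^ l) := by
    intro m l hml ha
    obtain ⟨k, i, j, hk⟩ := h.exists_of_centralizes (hx.mul_left (hst.pow_left m)) ha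
    refine ⟨k, i, j, l, ?_⟩
    rw [← mul_assoc, ← hk, mul_assoc, ← pow_add, hml, s3, mul_one]
  rcases h.inner_cases hx with h' | ⟨h1, h2⟩ | ⟨h1, h2⟩
  · exact step 0 3 rfl (by simpa using h'.1)
  · refine step 2 1 rfl ?_
    simp only [← conj_eq_iff_commute, sq, map_mul, MulAut.mul_apply, hsa, hsb, h2, h.ab_a]
  · refine step 1 2 rfl ?_
    simp only [← conj_eq_iff_commute, pow_one, map_mul, MulAut.mul_apply, hsa, h1, h2, h.b_ab]

theorem sq_cases {g : G} (hg : ¬ Commute g t) :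
    g ^ 2 = 1 ∨ g ^ 2 = a ∨ g ^ 2 = b ∨ g ^ 2 = a * b := by
  by_cases hg2 : g ^ 2 = 1
  · exact Or.inl hg2
  · refine Or.inr (h.six.mem_of_commute ?_ ?_ hg2)
    · rw [sq]
      exact h.six.commute_mul hg hg
    · rw [← pow_mul, h.six.pow_four_of_not_commute hg]

/-- The square of `g` is fixed by `g`, so it is 1 or `a`. In the second case `g * b` has square `(a
* b) * a * b = 1`. -/
theorem exists_involution {g : G} (hg : ¬ Commute g t) (hga : MulAut.conj g a = a)
    (hgb : MulAut.conj g b = a * b) : ∃ w : G, w ^ 2 = 1 ∧ ¬ Commute w t ∧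
      MulAut.conj w a = a ∧ MulAut.conj w b = a * b := by
  have hself : MulAut.conj g (g ^ 2) = g ^ 2 :=
    conj_eq_iff_commute.2 ((Commute.refl g).pow_right 2)
  rcases h.sq_cases hg with h2 | h2 | h2 | h2
  · exact ⟨g, h2, hg, hga, hgb⟩
  · refine ⟨g * b, ?_, ?_, ?_, ?_⟩
    · rw [mul_sq_eq, hgb, h2, h.ab_a, h.bb]
    · rwa [SixData.commute_mul_iff h.six.tv.symm]
    · rw [conj_mul_eq h.comm.symm, hga]
    · rw [conj_mul_eq (Commute.refl b), hgb]
  · rw [h2, hgb] at hself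
    exact absurd hself.symm h.six.hvw
  · rw [h2, map_mul, hga, hgb, h.a_ab] at hself
    exact absurd hself h.six.hvw

/-- Inversion of `s` by `w` means `(w * s) ^ 2 = 1`. As `w * s` exchanges `a` and `b`, its square is
1 or `a * b`; in the second case `s * a` replaces `s`. -/
theorem exists_inverted_rotation {w s : G} (w2 : w ^ 2 = 1) (hw : ¬ Commute w t)
    (hwa : MulAut.conj w a = a) (hwb : MulAut.conj w b = a * b) (s3 : s ^ 3 = 1)
    (hst : Commute s t) (hsa : MulAut.conj s a = a * b) (hsb : MulAut.conj s b = a) :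
    ∃ s : G, s ^ 3 = 1 ∧ Commute s t ∧ MulAut.conj s a = a * b ∧ MulAut.conj s b = a ∧
      MulAut.conj w s = s⁻¹ := by
  have inv_of : ∀ r : G, (w * r) ^ 2 = 1 → MulAut.conj w r = r⁻¹ := by
    intro r hr
    rwa [mul_sq_eq, w2, mul_one, mul_eq_one_iff_eq_inv] at hr
  have hq : ¬ Commute (w * s) t := by rwa [SixData.commute_mul_iff hst]
  have hqa : MulAut.conj (w * s) a = b := by rw [conj_mul_apply, hsa, map_mul, hwa, hwb, h.a_ab]
  have hqb : MulAut.conj (w * s) b = a := by rw [conj_mul_apply, hsb, hwa]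
  have hself : MulAut.conj (w * s) ((w * s) ^ 2) = (w * s) ^ 2 :=
    conj_eq_iff_commute.2 ((Commute.refl _).pow_right 2)
  rcases h.sq_cases hq with h2 | h2 | h2 | h2
  · exact ⟨s, s3, hst, hsa, hsb, inv_of s h2⟩
  · rw [h2, hqa] at hself
    exact absurd hself.symm h.six.huv
  · rw [h2, hqb] at hself
    exact absurd hself h.six.huv
  · refine ⟨s * a, ?_, hst.mul_left h.six.tu.symm, ?_, ?_, inv_of _ ?_⟩
    -- The cube of `s * a` is the product of the conjugates of `a` by `s`, `s ^ 2`, `s ^ 3`, namely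
    -- `(a * b) * b * a = 1`.
    · rw [pow_succ, mul_sq_eq, hsa, mul_assoc _ a, ← mul_assoc a s a]
      have : s ^ 2 * (a * s * a) = MulAut.conj (s ^ 2) a * s ^ 3 * a := by
        simp [pow_succ, mul_assoc]
      rw [mul_assoc (a * b), this, s3, mul_one, sq, conj_mul_apply, hsa, map_mul, hsa, hsb,
        h.ab_a, h.ba, ← sq, h.six.w2]
    · rw [conj_mul_eq (Commute.refl a), hsa]
    · rw [conj_mul_eq h.comm, hsb]
    · rw [← mul_assoc, mul_sq_eq, hqa, h2, h.b_ab, h.aa]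

end
end KleinData

/-! ### Explicit isomorphisms in the commuting case -/

theorem cyc_prod_hom_ext {N G : Type*} [Group N] [Group G] {n : ℕ} [NeZero n]
    {f g : Cyc n × N →* G} (h1 : f (gen n, 1) = g (gen n, 1)) (h2 : ∀ x, f (1, x) = g (1, x)) :
    f = g := by
  have h : f.comp (MonoidHom.inl _ _) = g.comp (MonoidHom.inl _ _) := cyc_hom_ext h1
  refine MonoidHom.ext fun x => ?_
  rw [← Prod.fst_mul_snd x, map_mul, map_mul, h2]
  exact congrArg (· * _) (DFunLike.congr_fun h x.1)

theorem cyclic_semidirect_hom_ext {N G : Type*} [Group N] [Group G] {n : ℕ} [NeZero n]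
    {φ : Cyc n →* MulAut N} {f g : N ⋊[φ] Cyc n →* G}
    (h1 : ∀ x, f (SemidirectProduct.inl x) = g (SemidirectProduct.inl x))
    (h2 : f (SemidirectProduct.inr (gen n)) = g (SemidirectProduct.inr (gen n))) : f = g :=
  SemidirectProduct.hom_ext (MonoidHom.ext h1) (cyc_hom_ext h2)

theorem cycProd_gen {N G : Type*} [Group N] [Group G] {n : ℕ} [NeZero n] {g : G} {hg : g ^ n = 1}
    {f : N →* G} {h : ∀ x, Commute g (f x)} (hn : 1 < n) :
    cycProd n g hg f h (gen n, 1) = g := by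
  have : Fact (1 < n) := ⟨hn⟩
  simp [cycProd_apply, ZMod.val_one]

theorem cycProd_one_left {N G : Type*} [Group N] [Group G] {n : ℕ} [NeZero n] {g : G}
    {hg : g ^ n = 1} {f : N →* G} {h : ∀ x, Commute g (f x)} (x : N) :
    cycProd n g hg f h (1, x) = f x := by
  simp [cycProd_apply]

theorem exists_cycProd {N G : Type*} [Group N] [Group G] {n : ℕ} [NeZero n] {g : G}
    {hg : g ^ n = 1} {f : N →* G} {h : ∀ x, Commute g (f x)} (k : ℕ) (x : N) :
    ∃ z, cycProd n g hg f h z = g ^ k * f x :=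
  ⟨(Multiplicative.ofAdd (k : ZMod n), x), by
    rw [cycProd_apply, toAdd_ofAdd, ZMod.val_natCast, ← pow_eq_pow_mod _ hg]⟩

/-- The automorphism of the Klein four group rotating `(x, 1)`, `(x, x)`, `(1, x)`. -/
def fourRot : MulAut (Cyc 2 × Cyc 2) where
  toFun p := (p.1 * p.2, p.1)
  invFun p := (p.2, p.1 * p.2)
  left_inv := by unfold Function.LeftInverse; decide
  right_inv := by unfold Function.RightInverse Function.LeftInverse; decide
  map_mul' := by decide

theorem fourRot_pow_three : fourRot ^ 3 = 1 := by
  apply MulEquiv.ext; decide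

/-- The alternating group on four letters as a semidirect product. -/
abbrev FourByThree : Type := (Cyc 2 × Cyc 2) ⋊[cyclicAction 3 fourRot fourRot_pow_three] Cyc 3

namespace KleinData
variable {G : Type*} [Group G] {t a b : G} (h : KleinData t a b)

include h

/-- The homomorphism from the Klein four group onto `{1, a, b, a b}`. -/
def fourHom : Cyc 2 × Cyc 2 →* G :=
  cycProd 2 a h.six.u2 (cycHom 2 b h.six.v2) fun _ => h.comm.pow_right _

theorem fourHom_fst : h.fourHom (gen 2, 1) = a := cycProd_gen one_lt_two

theorem fourHom_snd : h.fourHom (1, gen 2) = b :=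
  (cycProd_one_left _).trans (cycHom_gen 2 one_lt_two _ _)

theorem exists_fourHom (i j : ℕ) : ∃ x, h.fourHom x = a ^ i * b ^ j :=
  ⟨(gen 2, 1) ^ i * (1, gen 2) ^ j, by rw [map_mul, map_pow, map_pow, fourHom_fst, fourHom_snd]⟩

theorem fourHom_apply (x : Cyc 2 × Cyc 2) :
    ∃ i j : ℕ, i < 2 ∧ j < 2 ∧ h.fourHom x = a ^ i * b ^ j :=
  ⟨_, _, ZMod.val_lt _, ZMod.val_lt _, rfl⟩

theorem commute_fourHom {z : G} (hza : Commute z a) (hzb : Commute z b) (x : Cyc 2 × Cyc 2) :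
    Commute z (h.fourHom x) := by
  obtain ⟨i, j, -, -, hx⟩ := h.fourHom_apply x
  exact hx ▸ (hza.pow_right i).mul_right (hzb.pow_right j)

theorem fourHom_injective : Function.Injective h.fourHom := by
  refine cycProd_injective
    (cycHom_injective (pow_ne_one_of_prime Nat.prime_two h.six.v2 h.six.v1)) ?_
  rintro d h0 h2 ⟨x, hx⟩
  obtain rfl : d = 1 := by omega
  rw [cycHom_apply, pow_one] at hx
  have := ZMod.val_lt (n := 2) (Multiplicative.toAdd x)
  interval_cases (ZMod.val (n := 2) (Multiplicative.toAdd x))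
  · exact h.six.u1 (by simpa using hx.symm)
  · exact h.six.huv (by simpa using hx.symm)

/-- The homomorphism from `ℤ_6 × ℤ_2` onto the centralizer of `t`, `a` and `b`. -/
def sixTwoHom : Cyc 6 × Cyc 2 →* G :=
  cycProd 6 (t * a) (by
      rw [h.six.tu.mul_pow, pow_mul t 3 2, h.six.t3, pow_mul a 2 3, h.six.u2, one_pow, one_pow,
        one_mul])
    (cycHom 2 b h.six.v2) fun _ => (h.six.tv.mul_left h.comm).pow_right _

theorem sixTwoHom_fst : h.sixTwoHom (gen 6, 1) = t * a := cycProd_gen (by norm_num)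

theorem sixTwoHom_snd : h.sixTwoHom (1, gen 2) = b :=
  (cycProd_one_left _).trans (cycHom_gen 2 one_lt_two _ _)

theorem mem_range_sixTwoHom {y : G} : y ∈ h.sixTwoHom.range ↔ Commute y t ∧ Commute y a := by
  constructor
  · rintro ⟨x, rfl⟩
    have hx : h.sixTwoHom x = (t * a) ^ _ * b ^ _ := rfl
    rw [hx]
    exact ⟨(((Commute.refl t).mul_left h.six.tu.symm).pow_left _).mul_left
      (h.six.tv.symm.pow_left _), ((h.six.tu.mul_left (Commute.refl a)).pow_left _).mul_left
      (h.comm.symm.pow_left _)⟩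
  · rintro ⟨hyt, hya⟩
    obtain ⟨k, i, j, rfl⟩ := h.exists_of_centralizes hyt hya
    have ht : t ∈ h.sixTwoHom.range :=
      ⟨(gen 6, 1) ^ 4, by rw [map_pow, sixTwoHom_fst, mul_pow_four h.six.t3 h.six.u2 h.six.tu]⟩
    have ha : a ∈ h.sixTwoHom.range :=
      ⟨(gen 6, 1) ^ 3, by rw [map_pow, sixTwoHom_fst, mul_pow_three h.six.t3 h.six.u2 h.six.tu]⟩
    have hb : b ∈ h.sixTwoHom.range := ⟨_, h.sixTwoHom_snd⟩
    exact mul_mem (pow_mem ht k) (mul_mem (pow_mem ha i) (pow_mem hb j))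

theorem sixTwoHom_injective : Function.Injective h.sixTwoHom := by
  refine cycProd_injective
    (cycHom_injective (pow_ne_one_of_prime Nat.prime_two h.six.v2 h.six.v1)) ?_
  rintro d h0 h6 ⟨x, hx⟩
  have ho := orderOf_mul_eq_six h.six.t3 h.six.t1 h.six.u2 h.six.u1 h.six.tu
  have h2 : (t * a) ^ (d * 2) = 1 := by
    rw [pow_mul, ← hx, cycHom_apply, ← pow_mul, mul_comm, pow_mul, h.six.v2, one_pow]
  have hd := orderOf_dvd_of_pow_eq_one h2
  rw [ho] at hd
  -- Squaring kills the power of `b`, so 6 divides `2 * d`; the surviving value gives `(t * a) ^ 3 =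
  -- a`, which is not a power of `b`.
  obtain rfl : d = 3 := by omega
  rw [mul_pow_three h.six.t3 h.six.u2 h.six.tu, cycHom_apply] at hx
  have := ZMod.val_lt (n := 2) (Multiplicative.toAdd x)
  interval_cases (ZMod.val (n := 2) (Multiplicative.toAdd x))
  · exact h.six.u1 (by simpa using hx.symm)
  · exact h.six.huv (by simpa using hx.symm)

theorem nonempty_mulEquiv_two_six (hG : ∀ y : G, Commute y t ∧ Commute y a) :
    Nonempty (G ≃* Cyc 2 × Cyc 6) :=
  ⟨(MulEquiv.ofBijective h.sixTwoHom
    ⟨h.sixTwoHom_injective, fun y => h.mem_range_sixTwoHom.2 (hG y)⟩).symm.trans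
      MulEquiv.prodComm⟩

theorem commute_mul_inv {w y : G} (hw : ¬ Commute w t) (hy : ¬ Commute y t) :
    Commute (y * w⁻¹) t :=
  h.six.commute_mul hy fun h' => hw (by simpa using h'.inv_left)

/-- The centralizer of `t` is the product of the groups generated by `t * a` and `b`. Conjugation by
`w` inverts `t * a` and sends `b` to `a * b = (t * a) ^ 3 * b`, which is `autSixTwo`. -/
theorem nonempty_mulEquiv_sixTwoByTwo (hC : ∀ y : G, Commute y t → Commute y a) {w : G}
    (w2 : w ^ 2 = 1) (hw : ¬ Commute w t) (hwa : MulAut.conj w a = a)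
    (hwb : MulAut.conj w b = a * b) : Nonempty (G ≃* SixTwoByTwo) := by
  have hcomp : h.sixTwoHom.comp autSixTwo.toMonoidHom =
      (MulAut.conj w).toMonoidHom.comp h.sixTwoHom := by
    refine cyc_prod_hom_ext ?_ fun x => ?_
    · have h1 : autSixTwo (gen 6, 1) = (gen 6, 1)⁻¹ := by decide
      change h.sixTwoHom (autSixTwo (gen 6, 1)) = MulAut.conj w (h.sixTwoHom (gen 6, 1))
      rw [h1, map_inv, sixTwoHom_fst, map_mul, h.six.conj_eq_inv hw, hwa, h.six.tu.eq, mul_inv_rev,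
        inv_eq_self_of_sq h.six.u2]
    · refine DFunLike.congr_fun (f := (h.sixTwoHom.comp autSixTwo.toMonoidHom).comp
        (MonoidHom.inr _ _)) (g := ((MulAut.conj w).toMonoidHom.comp h.sixTwoHom).comp
        (MonoidHom.inr _ _)) (cyc_hom_ext ?_) x
      have h1 : autSixTwo (1, gen 2) = (gen 6, 1) ^ 3 * (1, gen 2) := by decide
      change h.sixTwoHom (autSixTwo (1, gen 2)) = MulAut.conj w (h.sixTwoHom (1, gen 2))
      rw [h1, map_mul, map_pow, sixTwoHom_fst, sixTwoHom_snd, hwb,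
        mul_pow_three h.six.t3 h.six.u2 h.six.tu]
  refine ⟨(MulEquiv.ofBijective (cyclicLift autSixTwo_sq h.sixTwoHom w w2
    (DFunLike.congr_fun hcomp)) (cyclicLift_bijective h.sixTwoHom_injective ?_ ?_)).symm⟩
  · intro d h0 h2 hd
    obtain rfl : d = 1 := by omega
    rw [pow_one] at hd
    exact hw (h.mem_range_sixTwoHom.1 hd).1
  · intro y
    have hr : ∀ {z : G}, Commute z t → ∃ x, h.sixTwoHom x = z := fun hz =>
      h.mem_range_sixTwoHom.2 ⟨hz, hC _ hz⟩
    by_cases hy : Commute y t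
    · obtain ⟨x, rfl⟩ := hr hy
      exact ⟨x, 0, by simp⟩
    · obtain ⟨x, hx⟩ := hr (h.commute_mul_inv hw hy)
      exact ⟨x, 1, by rw [hx]; simp⟩

theorem exists_of_central (hG : ∀ y : G, Commute y a) {w : G} (hw : ¬ Commute w t) (y : G) :
    ∃ i j k l : ℕ, y = a ^ i * (b ^ j * (t ^ k * w ^ l)) := by
  have hr : ∀ {z : G}, Commute z t → ∃ i j k : ℕ, z = a ^ i * (b ^ j * t ^ k) := by
    intro z hz
    obtain ⟨k, i, j, hk⟩ := h.exists_of_centralizes hz (hG z)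
    refine ⟨i, j, k, ?_⟩
    rw [hk, ((h.six.tu.pow_pow k i).mul_right (h.six.tv.pow_pow k j)).eq, mul_assoc]
  by_cases hy : Commute y t
  · obtain ⟨i, j, k, hk⟩ := hr hy
    exact ⟨i, j, k, 0, by simpa using hk⟩
  · obtain ⟨i, j, k, hk⟩ := hr (h.commute_mul_inv hw hy)
    refine ⟨i, j, k, 1, ?_⟩
    rw [← inv_mul_cancel_right y w, hk]
    simp only [pow_one, mul_assoc]

theorem ne_pow {z : G} (z2 : z ^ 2 = 1) (z1 : z ≠ 1) (k : ℕ) : z ≠ t ^ k := by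
  intro hz
  have z3 : z ^ 3 = 1 := by rw [hz, ← pow_mul, mul_comm, pow_mul, h.six.t3, one_pow]
  rw [pow_succ, z2, one_mul] at z3
  exact z1 z3

/-- The group generated by `t` and `w` is dihedral and contains no involution commuting with `t`, so
it meets the central four group trivially. -/
theorem nonempty_mulEquiv_two_two_symm (hG : ∀ y : G, Commute y a ∧ Commute y b) {w : G}
    (w2 : w ^ 2 = 1) (hw : ¬ Commute w t) :
    Nonempty (G ≃* Cyc 2 × Cyc 2 × Equiv.Perm (Fin 3)) := by
  have w1 : w ≠ 1 := by
    rintro rfl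
    exact hw (Commute.one_left t)
  have hwt := h.six.conj_eq_inv hw
  have hdih : Function.Injective (dihHom h.six.t3 w2 hwt) := dihHom_injective h.six.t1 w1
  have hnot : ∀ z : G, z ^ 2 = 1 → z ≠ 1 → Commute z t →
      z ∉ (dihHom h.six.t3 w2 hwt).range := by
    rintro z z2 z1 hz ⟨x, hx⟩
    obtain ⟨k, l, hl, hx'⟩ := dihHom_apply (r3 := h.six.t3) (u2 := w2) (hur := hwt) x
    rw [hx] at hx'
    interval_cases l
    · exact h.ne_pow z2 z1 k (by simpa using hx')
    · rw [pow_one, ← inv_mul_eq_iff_eq_mul] at hx'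
      rw [← hx'] at hw
      exact hw (((Commute.refl t).pow_left k).inv_left.mul_left hz)
  have hb : ∀ d, 0 < d → d < 2 → b ^ d ∉ (dihHom h.six.t3 w2 hwt).range := by
    intro d h0 h2
    obtain rfl : d = 1 := by omega
    rw [pow_one]
    exact hnot b h.six.v2 h.six.v1 h.six.tv.symm
  refine ⟨(MulEquiv.ofBijective (cycProd 2 a h.six.u2 (cycProd 2 b h.six.v2
    (dihHom h.six.t3 w2 hwt) fun x => (hG _).2.symm) fun x => (hG _).1.symm)
    (cycProd_bijective (cycProd_injective hdih hb) ?_ ?_)).symm.trans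
      ((MulEquiv.refl _).prodCongr ((MulEquiv.refl _).prodCongr dihEquivPerm))⟩
  -- If `a` is a power of `b` times a dihedral element, then `a` or `a * b` is dihedral.
  · rintro d h0 h2 ⟨x, hx⟩
    obtain rfl : d = 1 := by omega
    rw [pow_one, cycProd_apply] at hx
    have := ZMod.val_lt (n := 2) (Multiplicative.toAdd x.1)
    interval_cases (ZMod.val (n := 2) (Multiplicative.toAdd x.1))
    · exact hnot a h.six.u2 h.six.u1 h.six.tu.symm ⟨x.2, by simpa using hx⟩
    · refine hnot (a * b) h.six.w2 h.six.w1 h.six.tw.symm ⟨x.2, ?_⟩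
      rw [pow_one, ← eq_inv_mul_iff_mul_eq, inv_eq_self_of_sq h.six.v2] at hx
      exact hx.trans h.ba
  · intro y
    obtain ⟨i, j, k, l, rfl⟩ := h.exists_of_central (fun y => (hG y).1) hw y
    obtain ⟨x, hx⟩ := exists_dihHom (r3 := h.six.t3) (u2 := w2) (hur := hwt) k l
    obtain ⟨z, hz⟩ := exists_cycProd (hg := h.six.v2)
      (h := fun x => (hG (dihHom h.six.t3 w2 hwt x)).2.symm) j x
    exact ⟨z, i, by rw [hz, hx]⟩

/-- Since `a = w ^ 2`, the subgroup generated by `t` and `w` absorbs `a`, and `b` generates a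
central complement. -/
theorem nonempty_mulEquiv_two_threeByFour (hG : ∀ y : G, Commute y a ∧ Commute y b) {w : G}
    (w2 : w ^ 2 = a) (hw : ¬ Commute w t) : Nonempty (G ≃* Cyc 2 × ThreeByFour) := by
  have w4 : w ^ 4 = 1 := h.six.pow_four_of_not_commute hw
  have w3 : w ^ 3 = a * w := by rw [pow_succ, w2]
  have hwt := h.six.conj_eq_inv hw
  have hw3 : ¬ Commute (w ^ 3) t := by
    rw [w3, ← (hG w).1.eq]
    rwa [SixData.commute_mul_iff h.six.tu.symm]
  set f := cyclicLift (N := Cyc 3) (α := invThree) invThree_pow_four (cycHom 3 t h.six.t3) w w4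
    (fun x => by
      refine (map_inv (cycHom 3 t h.six.t3) x).trans ?_
      rw [← MulAut.conj_apply, cycHom_apply, map_pow, hwt, inv_pow]) with hf
  have hcomm : ∀ k : ℕ, Commute (t ^ k) t := fun k => (Commute.refl t).pow_left k
  have hinj : Function.Injective f := by
    refine cyclicLift_injective
      (cycHom_injective (pow_ne_one_of_prime Nat.prime_three h.six.t3 h.six.t1)) ?_
    rintro d h0 h4 ⟨x, hx⟩
    rw [cycHom_apply] at hx
    interval_cases d
    · rw [pow_one] at hx
      exact hw (hx ▸ hcomm _)
    · rw [w2] at hx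
      exact h.ne_pow h.six.u2 h.six.u1 _ hx.symm
    · exact hw3 (hx ▸ hcomm _)
  refine ⟨(MulEquiv.ofBijective (cycProd 2 b h.six.v2 f fun x => (hG _).2.symm)
    (cycProd_bijective hinj ?_ ?_)).symm⟩
  · rintro d h0 h2 ⟨x, hx⟩
    obtain rfl : d = 1 := by omega
    obtain ⟨k, l, hl, hx'⟩ : ∃ k l : ℕ, l < 4 ∧ f x = t ^ k * w ^ l :=
      ⟨_, _, ZMod.val_lt _, rfl⟩
    rw [hx, pow_one] at hx'
    have hcb : ∀ z : G, b = t ^ k * z → Commute z t := by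
      intro z hz
      rw [← inv_mul_eq_iff_eq_mul] at hz
      exact hz ▸ (hcomm k).inv_left.mul_left h.six.tv.symm
    interval_cases l
    · exact h.ne_pow h.six.v2 h.six.v1 k (by simpa using hx')
    · exact hw (hcb w (by simpa using hx'))
    · rw [w2] at hx'
      refine h.ne_pow h.six.w2 h.six.w1 k ?_
      rw [← h.ba, hx', mul_assoc, h.aa, mul_one]
    · exact hw3 (hcb _ hx')
  · intro y
    obtain ⟨i, j, k, l, rfl⟩ := h.exists_of_central (fun y => (hG y).1) hw y
    -- The exponent `2 * i` accounts for `a ^ i = w ^ (2 * i)`.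
    obtain ⟨x, hx⟩ : ∃ x, f x = t ^ k * w ^ (2 * i + l) :=
      ⟨⟨Multiplicative.ofAdd (k : ZMod 3), Multiplicative.ofAdd ((2 * i + l : ℕ) : ZMod 4)⟩, by
        rw [pow_eq_pow_mod k h.six.t3, pow_eq_pow_mod _ w4, ← ZMod.val_natCast,
          ← ZMod.val_natCast]
        rfl⟩
    refine ⟨x, j, ?_⟩
    rw [hx, pow_add, pow_mul, w2, ← mul_assoc (t ^ k), (h.six.tu.pow_pow k i).eq, mul_assoc]
    exact (h.comm.pow_pow i j).left_comm _

theorem not_commute_rotation_pow {s : G} (hsa : MulAut.conj s a = a * b)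
    (hsb : MulAut.conj s b = a) {d : ℕ} (h0 : 0 < d) (h3 : d < 3) : ¬ Commute (s ^ d) a := by
  rw [← conj_eq_iff_commute, mulAut_conj_pow]
  interval_cases d
  · simpa only [Function.iterate_one, hsa] using h.six.huw.symm
  · simpa only [Function.iterate_succ, Function.iterate_zero, Function.comp_apply, id, hsa, map_mul,
      hsb, h.ab_a] using h.six.huv.symm

section
variable {s : G} (s3 : s ^ 3 = 1) (hsa : MulAut.conj s a = a * b) (hsb : MulAut.conj s b = a)

/-- The homomorphism from the alternating group of degree four given by an element `s` of order
three rotating `a`, `a b`, `b`. -/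
def rotHom : FourByThree →* G :=
  cyclicLift fourRot_pow_three h.fourHom s s3 (by
    have : h.fourHom.comp fourRot.toMonoidHom = (MulAut.conj s).toMonoidHom.comp h.fourHom := by
      refine cyc_prod_hom_ext ?_ fun x => ?_
      · have h1 : fourRot (gen 2, 1) = (gen 2, 1) * (1, gen 2) := by decide
        change h.fourHom (fourRot (gen 2, 1)) = MulAut.conj s (h.fourHom (gen 2, 1))
        rw [h1, map_mul, fourHom_fst, fourHom_snd, hsa]
      · refine DFunLike.congr_fun (f := (h.fourHom.comp fourRot.toMonoidHom).comp
          (MonoidHom.inr _ _)) (g := ((MulAut.conj s).toMonoidHom.comp h.fourHom).comp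
          (MonoidHom.inr _ _)) (cyc_hom_ext ?_) x
        have h1 : fourRot (1, gen 2) = (gen 2, 1) := by decide
        change h.fourHom (fourRot (1, gen 2)) = MulAut.conj s (h.fourHom (1, gen 2))
        rw [h1, fourHom_fst, fourHom_snd, hsb]
    exact DFunLike.congr_fun this)

theorem rotHom_inl (x : Cyc 2 × Cyc 2) :
    h.rotHom s3 hsa hsb (SemidirectProduct.inl x) = h.fourHom x := cyclicLift_inl x

theorem rotHom_gen : h.rotHom s3 hsa hsb (SemidirectProduct.inr (gen 3)) = s :=
  cyclicLift_gen (by norm_num)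

theorem rotHom_apply (x : FourByThree) :
    ∃ i j l : ℕ, l < 3 ∧ h.rotHom s3 hsa hsb x = a ^ i * b ^ j * s ^ l :=
  ⟨_, _, _, ZMod.val_lt _, rfl⟩

theorem exists_rotHom (i j l : ℕ) :
    ∃ x, h.rotHom s3 hsa hsb x = a ^ i * b ^ j * s ^ l := by
  obtain ⟨x, hx⟩ := h.exists_fourHom i j
  exact ⟨SemidirectProduct.inl x * SemidirectProduct.inr (gen 3) ^ l, by
    rw [map_mul, map_pow, rotHom_inl, rotHom_gen, hx]⟩

theorem rotHom_injective : Function.Injective (h.rotHom s3 hsa hsb) := by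
  refine cyclicLift_injective h.fourHom_injective ?_
  rintro d h0 hd ⟨x, hx⟩
  refine h.not_commute_rotation_pow hsa hsb h0 hd ?_
  rw [← hx]
  exact (h.commute_fourHom (Commute.refl a) h.comm x).symm

/-- The homomorphism from `ℤ_3 × A_4` given by `t` and an element `s` of order three rotating
`a`, `a b`, `b`. -/
def threeRotHom (hst : Commute s t) : Cyc 3 × FourByThree →* G :=
  cycProd 3 t h.six.t3 (h.rotHom s3 hsa hsb) fun x => by
    obtain ⟨i, j, l, -, hx⟩ := h.rotHom_apply s3 hsa hsb x
    rw [hx]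
    exact ((h.six.tu.pow_right i).mul_right (h.six.tv.pow_right j)).mul_right
      (hst.symm.pow_right l)

theorem threeRotHom_one_left (hst : Commute s t) (x : FourByThree) :
    h.threeRotHom s3 hsa hsb hst (1, x) = h.rotHom s3 hsa hsb x := by
  rw [threeRotHom, cycProd_one_left]

/-- A power of `t` commutes with `a`, which forces `l = 0`; it then lies in the four group, so its
square and cube are both trivial. -/
theorem threeRotHom_injective (hst : Commute s t) :
    Function.Injective (h.threeRotHom s3 hsa hsb hst) := by
  refine cycProd_injective (h.rotHom_injective s3 hsa hsb) ?_
  rintro d h0 h3 ⟨x, hx⟩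
  obtain ⟨i, j, l, hl, hx'⟩ := h.rotHom_apply s3 hsa hsb x
  rw [hx] at hx'
  have hab : Commute (a ^ i * b ^ j) a :=
    ((Commute.refl a).pow_left i).mul_left (h.comm.symm.pow_left j)
  have hl0 : l = 0 := by
    by_contra hne
    refine h.not_commute_rotation_pow hsa hsb (Nat.pos_of_ne_zero hne) hl ?_
    rw [← inv_mul_eq_iff_eq_mul] at hx'
    exact hx' ▸ hab.inv_left.mul_left (h.six.tu.pow_left d)
  subst hl0
  rw [pow_zero, mul_one] at hx'
  have h2 : (t ^ d) ^ 2 = 1 := by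
    rw [hx', (h.comm.pow_pow i j).mul_pow, ← pow_mul, ← pow_mul, mul_comm i, mul_comm j, pow_mul,
      pow_mul, h.six.u2, h.six.v2, one_pow, one_pow, one_mul]
  have h3' : (t ^ d) ^ 3 = 1 := by rw [← pow_mul, mul_comm, pow_mul, h.six.t3, one_pow]
  rw [pow_succ, h2, one_mul] at h3'
  exact pow_ne_one_of_prime Nat.prime_three h.six.t3 h.six.t1 d h0 h3 h3'

theorem mem_range_threeRotHom (hst : Commute s t) {y : G} :
    y ∈ (h.threeRotHom s3 hsa hsb hst).range ↔ Commute y t := by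
  constructor
  · rintro ⟨x, rfl⟩
    obtain ⟨i, j, l, -, hx⟩ := h.rotHom_apply s3 hsa hsb x.2
    rw [threeRotHom, cycProd_apply, hx]
    exact ((Commute.refl t).pow_left _).mul_left (((h.six.tu.symm.pow_left i).mul_left
      (h.six.tv.symm.pow_left j)).mul_left (hst.pow_left l))
  · intro hy
    obtain ⟨k, i, j, l, rfl⟩ := h.exists_of_rotation s3 hst hsa hsb hy
    obtain ⟨x, hx⟩ := h.exists_rotHom s3 hsa hsb i j l
    rw [← hx]
    exact exists_cycProd k x

end
end KleinData

/-! ### The alternating group and the groups of order 36 and 72 -/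

/-- The rotation `(0 1 2)` as an even permutation of four letters. -/
def threeCycle : alternatingGroup (Fin 4) :=
  ⟨Equiv.swap 0 1 * Equiv.swap 1 2, Equiv.Perm.mem_alternatingGroup.2 (by decide)⟩

/-- The isomorphism from the semidirect product onto the alternating group, as a homomorphism. -/
def fourByThreeHom : FourByThree →* alternatingGroup (Fin 4) :=
  cyclicLift fourRot_pow_three
    (cycProd 2 doubleSwap (by decide +kernel) (cycHom 2 doubleSwap' (by decide +kernel))
      (by unfold Commute SemiconjBy; decide +kernel))
    threeCycle (by decide +kernel) (by decide +kernel)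

theorem fourByThreeHom_bijective : Function.Bijective fourByThreeHom := by decide +kernel

/-- The alternating group on four letters is `(ℤ_2 × ℤ_2) ⋊ ℤ_3`. -/
noncomputable def fourByThreeEquiv : FourByThree ≃* alternatingGroup (Fin 4) :=
  MulEquiv.ofBijective fourByThreeHom fourByThreeHom_bijective

namespace KleinData
variable {G : Type*} [Group G] {t a b : G} (h : KleinData t a b)
include h

theorem nonempty_mulEquiv_three_alt (hG : ∀ y : G, Commute y t) {s : G} (s3 : s ^ 3 = 1)
    (hsa : MulAut.conj s a = a * b) (hsb : MulAut.conj s b = a) :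
    Nonempty (G ≃* Cyc 3 × alternatingGroup (Fin 4)) :=
  ⟨(MulEquiv.ofBijective (h.threeRotHom s3 hsa hsb (hG s)) ⟨h.threeRotHom_injective _ _ _ _,
    fun y => (h.mem_range_threeRotHom s3 hsa hsb (hG s)).2 (hG y)⟩).symm.trans
      ((MulEquiv.refl _).prodCongr fourByThreeEquiv)⟩

theorem nonempty_mulEquiv_threeAltByTwo {w s : G} (w2 : w ^ 2 = 1) (hw : ¬ Commute w t)
    (hwa : MulAut.conj w a = a) (hwb : MulAut.conj w b = a * b) (s3 : s ^ 3 = 1)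
    (hst : Commute s t) (hsa : MulAut.conj s a = a * b) (hsb : MulAut.conj s b = a)
    (hws : MulAut.conj w s = s⁻¹) : Nonempty (G ≃* ThreeAltByTwo) := by
  let β : MulAut (alternatingGroup (Fin 4)) := MulAut.conjNormal (Equiv.swap (0 : Fin 4) 1)
  let A := h.rotHom s3 hsa hsb
  -- Conjugation by (0 1) fixes (0 1)(2 3), sends (0 2)(1 3) to (0 3)(1 2) and inverts (0 1 2),
  -- exactly as `w` acts on `a`, `b`, `s`. Agreement on these generators gives `hA`.
  have hβ1 : β (fourByThreeHom (SemidirectProduct.inl (gen 2, 1))) =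
      fourByThreeHom (SemidirectProduct.inl (gen 2, 1)) := by decide +kernel
  have hβ2 : β (fourByThreeHom (SemidirectProduct.inl (1, gen 2))) =
      fourByThreeHom (SemidirectProduct.inl (gen 2, gen 2)) := by decide +kernel
  have hβ3 : β (fourByThreeHom (SemidirectProduct.inr (gen 3))) =
      fourByThreeHom (SemidirectProduct.inr (gen 3))⁻¹ := by decide +kernel
  have hA : (A.comp fourByThreeEquiv.symm.toMonoidHom).comp
      (β.toMonoidHom.comp fourByThreeEquiv.toMonoidHom) = (MulAut.conj w).toMonoidHom.comp A := by
    have red : ∀ x y : FourByThree, β (fourByThreeHom x) = fourByThreeHom y →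
        A (fourByThreeEquiv.symm (β (fourByThreeEquiv x))) = A y := by
      intro x y hxy
      rw [show fourByThreeEquiv x = fourByThreeHom x from rfl, hxy]
      exact congrArg A (fourByThreeEquiv.symm_apply_apply y)
    refine cyclic_semidirect_hom_ext (fun x => ?_) ?_
    · refine DFunLike.congr_fun (f := ((A.comp fourByThreeEquiv.symm.toMonoidHom).comp
        (β.toMonoidHom.comp fourByThreeEquiv.toMonoidHom)).comp SemidirectProduct.inl)
        (g := ((MulAut.conj w).toMonoidHom.comp A).comp SemidirectProduct.inl)
        (cyc_prod_hom_ext ?_ fun x => ?_) x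
      · refine (red _ _ hβ1).trans ?_
        change h.rotHom s3 hsa hsb _ = MulAut.conj w (h.rotHom s3 hsa hsb _)
        rw [rotHom_inl, fourHom_fst, hwa]
      · refine DFunLike.congr_fun (f := (((A.comp fourByThreeEquiv.symm.toMonoidHom).comp
          (β.toMonoidHom.comp fourByThreeEquiv.toMonoidHom)).comp SemidirectProduct.inl).comp
          (MonoidHom.inr _ _)) (g := (((MulAut.conj w).toMonoidHom.comp A).comp
          SemidirectProduct.inl).comp (MonoidHom.inr _ _)) (cyc_hom_ext ?_) x
        refine (red _ _ hβ2).trans ?_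
        change h.rotHom s3 hsa hsb _ = MulAut.conj w (h.rotHom s3 hsa hsb _)
        have : ((gen 2, gen 2) : Cyc 2 × Cyc 2) = (gen 2, 1) * (1, gen 2) := rfl
        rw [this, rotHom_inl, map_mul, fourHom_fst, fourHom_snd, ← hwb]
        exact congrArg _ ((h.rotHom_inl s3 hsa hsb _).trans h.fourHom_snd).symm
    · refine (red _ _ hβ3).trans ?_
      change h.rotHom s3 hsa hsb _ = MulAut.conj w (h.rotHom s3 hsa hsb _)
      rw [map_inv, rotHom_gen, hws]
  let F : Cyc 3 × alternatingGroup (Fin 4) →* G := (h.threeRotHom s3 hsa hsb hst).comp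
    ((MulEquiv.refl _).prodCongr fourByThreeEquiv.symm).toMonoidHom
  have hFinj : Function.Injective F := (h.threeRotHom_injective s3 hsa hsb hst).comp
    ((MulEquiv.refl _).prodCongr fourByThreeEquiv.symm).injective
  have hFr : ∀ y, (∃ x, F x = y) ↔ Commute y t := by
    intro y
    rw [← h.mem_range_threeRotHom s3 hsa hsb hst]
    constructor
    · rintro ⟨x, hx⟩
      exact ⟨_, hx⟩
    · rintro ⟨x, rfl⟩
      exact ⟨((MulEquiv.refl _).prodCongr fourByThreeEquiv) x, congrArg
        (h.threeRotHom s3 hsa hsb hst) (MulEquiv.symm_apply_apply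
          ((MulEquiv.refl _).prodCongr fourByThreeEquiv) x)⟩
  have hF : F.comp autThreeAlt.toMonoidHom = (MulAut.conj w).toMonoidHom.comp F := by
    refine cyc_prod_hom_ext ?_ fun x => ?_
    · have h1 : autThreeAlt (gen 3, 1) = (gen 3, 1)⁻¹ := by decide +kernel
      have h2 : F (gen 3, 1) = t := by
        change h.threeRotHom s3 hsa hsb hst (gen 3, fourByThreeEquiv.symm 1) = t
        rw [map_one]
        exact cycProd_gen (by norm_num)
      change F (autThreeAlt (gen 3, 1)) = MulAut.conj w (F (gen 3, 1))
      rw [h1, map_inv, h2, h.six.conj_eq_inv hw]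
    · have h2 : ∀ y, F (1, y) = A (fourByThreeEquiv.symm y) := fun y =>
        h.threeRotHom_one_left s3 hsa hsb hst _
      have h1 : autThreeAlt (1, x) = (1, β x) := Prod.ext inv_one rfl
      change F (autThreeAlt (1, x)) = MulAut.conj w (F (1, x))
      rw [h1, h2, h2]
      have := DFunLike.congr_fun hA (fourByThreeEquiv.symm x)
      simpa using this
  refine ⟨(MulEquiv.ofBijective (cyclicLift autThreeAlt_sq F w w2 (DFunLike.congr_fun hF))
    (cyclicLift_bijective hFinj ?_ ?_)).symm⟩
  · intro d h0 h2 hd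
    obtain rfl : d = 1 := by omega
    rw [pow_one] at hd
    exact hw ((hFr w).1 hd)
  · intro y
    by_cases hy : Commute y t
    · obtain ⟨x, rfl⟩ := (hFr y).2 hy
      exact ⟨x, 0, by simp⟩
    · obtain ⟨x, hx⟩ := (hFr _).2 (h.commute_mul_inv hw hy)
      exact ⟨x, 1, by rw [hx]; simp⟩

end KleinData

/-! ### Assembling the classification -/

theorem KleinData.classification {G : Type*} [Group G] {t a b : G} (h : KleinData t a b) :
    Nonempty (G ≃* Cyc 2 × Cyc 6) ∨
      Nonempty (G ≃* Cyc 3 × Equiv.Perm (Fin 3)) ∨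
      Nonempty (G ≃* Cyc 2 × ThreeByFour) ∨
      Nonempty (G ≃* SixTwoByTwo) ∨
      Nonempty (G ≃* Cyc 2 × Cyc 2 × Equiv.Perm (Fin 3)) ∨
      Nonempty (G ≃* Cyc 3 × alternatingGroup (Fin 4)) ∨
      Nonempty (G ≃* ThreeAltByTwo) := by
  by_cases hG : ∀ y : G, Commute y t
  · by_cases hC : ∀ y : G, Commute y a ∧ Commute y b
    · exact Or.inl (h.nonempty_mulEquiv_two_six fun y => ⟨hG y, (hC y).1⟩)
    · push Not at hC
      obtain ⟨x, hx⟩ := hC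
      obtain ⟨s, s3, -, hsa, hsb⟩ := h.exists_rotation (hG x) fun h' => hx h'.1 h'.2
      have := h.nonempty_mulEquiv_three_alt hG s3 hsa hsb
      tauto
  push Not at hG
  obtain ⟨g, hg⟩ := hG
  by_cases hout : ∀ y : G, ¬ Commute y t → Commute y a ∧ Commute y b
  · have hall : ∀ y : G, Commute y a ∧ Commute y b := by
      intro y
      by_cases hy : Commute y t
      · have hyg := hout (g * y) (by rwa [SixData.commute_mul_iff hy])
        have hg' := hout g hg
        have hy' : y = g⁻¹ * (g * y) := (inv_mul_cancel_left g y).symm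
        rw [hy']
        exact ⟨hg'.1.inv_left.mul_left hyg.1, hg'.2.inv_left.mul_left hyg.2⟩
      · exact hout y hy
    have hab : ∀ y : G, Commute y (a * b) := fun y => (hall y).1.mul_right (hall y).2
    rcases h.sq_cases hg with g2 | g2 | g2 | g2
    · have := h.nonempty_mulEquiv_two_two_symm hall g2 hg
      tauto
    · have := h.nonempty_mulEquiv_two_threeByFour hall g2 hg
      tauto
    -- The basis is changed so that the square of `g` becomes its first member.
    · have := h.swap.nonempty_mulEquiv_two_threeByFour (fun y => (hall y).symm) g2 hg
      tauto
    · have := h.shear.swap.nonempty_mulEquiv_two_threeByFour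
        (fun y => ⟨hab y, (hall y).1⟩) g2 hg
      tauto
  · push Not at hout
    obtain ⟨g, hg, hgab⟩ := hout
    obtain ⟨a, b, h, hga, hgb⟩ := (h.outer_cases hg).resolve_left fun h' => hgab h'.1 h'.2
    obtain ⟨w, w2, hw, hwa, hwb⟩ := h.exists_involution hg hga hgb
    by_cases hC : ∀ y : G, Commute y t → Commute y a ∧ Commute y b
    · have := h.nonempty_mulEquiv_sixTwoByTwo (fun y hy => (hC y hy).1) w2 hw hwa hwb
      tauto
    · push Not at hC
      obtain ⟨x, hxt, hx⟩ := hC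
      obtain ⟨r, r3, hrt, hra, hrb⟩ := h.exists_rotation hxt fun h' => hx h'.1 h'.2
      obtain ⟨s, s3, hst, hsa, hsb, hws⟩ :=
        h.exists_inverted_rotation w2 hw hwa hwb r3 hrt hra hrb
      have := h.nonempty_mulEquiv_threeAltByTwo w2 hw hwa hwb s3 hst hsa hsb hws
      tauto

theorem theorem3p3 :
    (∀ (G : Type*) [Group G] [Finite G],
      elementOrders G ⊆ {1, 2, 3, 4, 6} → (cyclicSubgroups G 6).ncard = 3 →
      ((∃ H ∈ cyclicSubgroups G 6, ∃ K ∈ cyclicSubgroups G 6,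
          H ≠ K ∧ Nat.card (H ⊓ K : Subgroup G) = 3) ↔
        (Nonempty (G ≃* Cyc 2 × Cyc 6) ∨
          Nonempty (G ≃* Cyc 3 × Equiv.Perm (Fin 3)) ∨
          Nonempty (G ≃* Cyc 2 × ThreeByFour) ∨
          Nonempty (G ≃* SixTwoByTwo) ∨
          Nonempty (G ≃* Cyc 2 × Cyc 2 × Equiv.Perm (Fin 3)) ∨
          Nonempty (G ≃* Cyc 3 × alternatingGroup (Fin 4)) ∨
          Nonempty (G ≃* ThreeAltByTwo)))) ∧
    HasInvariants (Cyc 2 × Cyc 6) 12 {1, 2, 3, 6} ∧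
    HasInvariants (Cyc 3 × Equiv.Perm (Fin 3)) 18 {1, 2, 3, 6} ∧
    HasInvariants (Cyc 2 × ThreeByFour) 24 {1, 2, 3, 4, 6} ∧
    HasInvariants SixTwoByTwo 24 {1, 2, 3, 4, 6} ∧
    HasInvariants (Cyc 2 × Cyc 2 × Equiv.Perm (Fin 3)) 24 {1, 2, 3, 6} ∧
    HasInvariants (Cyc 3 × alternatingGroup (Fin 4)) 36 {1, 2, 3, 6} ∧
    HasInvariants ThreeAltByTwo 72 {1, 2, 3, 4, 6} := by
  refine ⟨?_, hasInvariants_two_six, hasInvariants_three_symm, hasInvariants_two_threeByFour,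
    hasInvariants_sixTwoByTwo, hasInvariants_two_two_symm, hasInvariants_three_alt,
    hasInvariants_threeAltByTwo⟩
  intro G _ _ hord hcard
  constructor
  · rintro ⟨H, hH, K, hK, hHK, h3⟩
    obtain ⟨t, u, v, ⟨hc, h⟩ | ⟨hc, h⟩⟩ := exists_sixData hord hcard hH hK hHK h3
    · exact KleinData.classification ⟨h, hc⟩
    · exact Or.inr (Or.inl (h.nonempty_mulEquiv_of_not_commute rfl hc))
  · rintro (⟨⟨e⟩⟩ | ⟨⟨e⟩⟩ | ⟨⟨e⟩⟩ | ⟨⟨e⟩⟩ | ⟨⟨e⟩⟩ | ⟨⟨e⟩⟩ | ⟨⟨e⟩⟩)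
    exacts [sixElements_two_six.exists_inf e, sixElements_three_symm.exists_inf e,
      sixElements_two_threeByFour.exists_inf e, sixElements_sixTwoByTwo.exists_inf e,
      sixElements_two_two_symm.exists_inf e, sixElements_three_alt.exists_inf e,
      sixElements_threeAltByTwo.exists_inf e]
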